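/- Let $n\ge 2$, let $I\subseteq\mathbb R$ be an open interval and let $\alpha:I\to\mathbb R^n$ be a curve of class $C^{n-1}$ whose derivatives $\alpha',\dots,\alpha^{(n-1)}$ are linearly independent at every point. Let $e_1,\dots,e_{n-1}$ be obtained from them by the Gram–Schmidt process, let $e_n$ be the unit vector completing them to a positively oriented orthonormal basis of $\mathbb R^n$, and assume that $e_1,\dots,e_{n-1}$ are differentiable (which is automatic if $\alpha$ is of class $C^n$). Call such a curve a Frenet curve; its curvatures are $k_i=\langle e_i',e_{i+1}\rangle/\|\alpha'\|$, $1\le i\le n-1$. Assume that all the curvatures of $\alpha$ are nowhere zero on $I$. Write $k=\lfloor n/2\rfloor$. For radii $r_1,\dots,r_k>0$ (and, if $n$ is odd, a real constant $a$), the flat torus in $\mathbb R^n$ is parametrized by $$x(u_1,\dots,u_k)=(r_1\cos u_1,r_1\sin u_1,\dots,r_k\cos u_k,r_k\sin u_k)\quad(n=2k),$$ with the additional constant last coordinate $a$ if $n=2k+1$. A twisted geodesic of this torus is a curve $\gamma(t)=x(m_1t,\dots,m_kt)$, $t\in\mathbb R$, with real constants $m_1,\dots,m_k$, which is a Frenet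 curve in $\mathbb R^n$ with nowhere zero curvature $k_{2k-1}$ (the last curvature of $\gamma$ within the $2k$-dimensional space containing it, up to sign). Then, for every $s_0\in I$, the following are equivalent: 1. all the ratios $k_{i+1}/k_i$, $1\le i\le n-2$, are constant on $I$; 2. there are a twisted geodesic $\gamma$ of a flat torus in $\mathbb R^n$ and an isometry $\Phi$ of $\mathbb R^n$ such that $$e_1(s)=\Phi\bigl(\gamma(t(s))\bigr)\quad\text{for all }s\in I,\qquad t(s)=\int_{s_0}^{s}k_1(u)\,\|\alpha'(u)\|\,du .$$ -/

import Mathlib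

/-- The `i`-th vector `e_i` (`1 ≤ i ≤ n`) of the Frenet frame of a curve `α` in `ℝⁿ` at the
parameter `s`. For `i < n` it is obtained from `α', α'', …` by the Gram-Schmidt process. The last
vector `e_n` is the generalized cross product of `e_1, …, e_{n-1}`: its `j`-th coordinate is the
determinant with rows `e_1, …, e_{n-1}` and the `j`-th standard basis vector, which makes
`e_1, …, e_n` a positively oriented orthonormal basis whenever `e_1, …, e_{n-1}` are
orthonormal. -/
noncomputable def frenetVector {n : ℕ} (α : ℝ → EuclideanSpace ℝ (Fin n)) (i : ℕ) (s : ℝ) :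
    EuclideanSpace ℝ (Fin n) :=
  if i < n then
    InnerProductSpace.gramSchmidtNormed ℝ (fun j : ℕ => iteratedDeriv (j + 1) α s) (i - 1)
  else
    WithLp.toLp 2 fun j : Fin n => Matrix.det (Matrix.of fun a b : Fin n =>
      if (a : ℕ) + 1 < n then
        InnerProductSpace.gramSchmidtNormed ℝ (fun l : ℕ => iteratedDeriv (l + 1) α s) (a : ℕ) b
      else if b = j then 1 else 0)

/-- The `i`-th curvature `k_i = ⟨e_i', e_{i+1}⟩ / ‖α'‖`, for `1 ≤ i ≤ n - 1`. -/
noncomputable def curvature {n : ℕ} (α : ℝ → EuclideanSpace ℝ (Fin n)) (i : ℕ) (s : ℝ) : ℝ :=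
  inner ℝ (deriv (frenetVector α i) s) (frenetVector α (i + 1) s) / ‖deriv α s‖

/-- Curves in `ℝⁿ` for which the Frenet frame and the curvatures are defined on the open set `I`:
`α` is of class `C^{n-1}`, its derivatives of orders `1, …, n - 1` are linearly independent, and
the vectors `e_1, …, e_{n-1}`, whose derivatives enter the curvatures, are differentiable.
(Every `C^n` curve with the first two properties has the third one.) -/
structure IsFrenetCurve {n : ℕ} (α : ℝ → EuclideanSpace ℝ (Fin n)) (I : Set ℝ) : Prop where
  contDiffOn : ContDiffOn ℝ ((n - 1 : ℕ) : WithTop ℕ∞) α I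
  linearIndependent : ∀ s ∈ I,
    LinearIndependent ℝ fun j : Fin (n - 1) => iteratedDeriv ((j : ℕ) + 1) α s
  differentiableOn : ∀ i, 1 ≤ i → i < n → DifferentiableOn ℝ (frenetVector α i) I

/-- All the quotients `k_{i+1} / k_i`, `1 ≤ i ≤ n - 2`, are constant on `I`. -/
def HasConstantCurvatureRatios {n : ℕ} (α : ℝ → EuclideanSpace ℝ (Fin n)) (I : Set ℝ) : Prop :=
  ∀ i, 1 ≤ i → i + 1 < n → ∃ c : ℝ, ∀ s ∈ I, curvature α (i + 1) s / curvature α i s = c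

/-- The parametrization
`(r₁ cos u₁, r₁ sin u₁, …, r_k cos u_k, r_k sin u_k)` of a flat torus in `ℝⁿ`, `n = 2k`,
respectively `(r₁ cos u₁, r₁ sin u₁, …, r_k cos u_k, r_k sin u_k, a)` if `n = 2k + 1`
(for even `n` the number `a` does not occur). -/
noncomputable def flatTorus (n : ℕ) (r : Fin (n / 2) → ℝ) (a : ℝ) (u : Fin (n / 2) → ℝ) :
    EuclideanSpace ℝ (Fin n) :=
  WithLp.toLp 2 fun j : Fin n =>
    if h : (j : ℕ) / 2 < n / 2 then
      if (j : ℕ) % 2 = 0 then r ⟨(j : ℕ) / 2, h⟩ * Real.cos (u ⟨(j : ℕ) / 2, h⟩)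
      else r ⟨(j : ℕ) / 2, h⟩ * Real.sin (u ⟨(j : ℕ) / 2, h⟩)
    else a

/-- `γ` is a geodesic `t ↦ x(m₁ t, …, m_k t)` of a flat torus `x` in `ℝⁿ`, where `k = n / 2`
(rounded down), and it is twisted: its Frenet frame exists and its curvature `k_{2k-1}` does not
vanish. If `n = 2k`, this is the last curvature. If `n = 2k + 1`, the curve lies in the
`2k`-dimensional hyperplane where the last coordinate is `a`, and `k_{2k-1}` is the last curvature
up to sign of `γ` as a curve in that hyperplane. -/
def IsTwistedTorusGeodesic {n : ℕ} (γ : ℝ → EuclideanSpace ℝ (Fin n)) : Prop :=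
  (∃ (r : Fin (n / 2) → ℝ) (a : ℝ) (m : Fin (n / 2) → ℝ), (∀ l, 0 < r l) ∧
    ∀ t, γ t = flatTorus n r a fun l => m l * t) ∧
  IsFrenetCurve γ Set.univ ∧ ∀ t, curvature γ (2 * (n / 2) - 1) t ≠ 0

/-! Put dt = k_1 ‖α'‖ ds. Constant ratios mean that in the parameter t the Frenet equations have
constant coefficients: the frame M satisfies dM/dt = M B with a fixed skew tridiagonal B, so e_1 =
M(s₀) exp(tB) b₀, where b₀ is the first standard basis vector. The nonzero off-diagonal entries make
b₀ cyclic for B (`mem_span_clm_pow_of_tridiagonal`). A skew operator splits the space into rotated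
planes and a kernel; cyclicity allows only one plane for each nonzero eigenvalue of B², at most a
line for the kernel, and a nonzero component of b₀ in every plane
(`exists_orthonormalBasis_of_skew`). In adapted coordinates exp(tB) b₀ is a torus curve γ
(`exists_flatTorus_of_skew`), and M(s₀) supplies the isometry. With C the infinitesimal rotation of
the torus, the independence of γ, Cγ, …, C^{n-1}γ makes γ a twisted Frenet curve
(`isFrenetCurve_of_clm`, `curvature_ne_zero_of_clm`).

Conversely, a torus curve solves γ' = Cγ with C skew, so the inner products of its derivatives do
not depend on t. This passes to e_1 and its t-derivatives, and Gram–Schmidt applied to a constant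
Gram matrix has constant coefficients; hence every k_i ‖α'‖ is a constant multiple of k_1 ‖α'‖
(`IsFrenetCurve.exists_inner_deriv_frenetVector_eq_mul`).

Both directions need t(s) to be a primitive of k_1 ‖α'‖. For n = 2 this function need not be
continuous, but it is locally the derivative of an angle and has no zeros, which suffices
(`IsFrenetCurve.hasDerivAt_integral_curvature`). -/

/-! ### Gram–Schmidt vectors and the generalized cross product. -/

open InnerProductSpace in
theorem gramSchmidtNormed_mem_span_image_Iic {E : Type*} [NormedAddCommGroup E]
    [InnerProductSpace ℝ E] (f : ℕ → E) (i : ℕ) :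
    gramSchmidtNormed ℝ f i ∈ Submodule.span ℝ (f '' Set.Iic i) := by
  rw [← span_gramSchmidt_Iic, ← span_gramSchmidtNormed]
  exact Submodule.subset_span ⟨i, Set.self_mem_Iic, rfl⟩

open InnerProductSpace in
theorem mem_span_gramSchmidtNormed_image_Iic {E : Type*} [NormedAddCommGroup E]
    [InnerProductSpace ℝ E] (f : ℕ → E) (i : ℕ) :
    f i ∈ Submodule.span ℝ (gramSchmidtNormed ℝ f '' Set.Iic i) := by
  rw [span_gramSchmidtNormed]
  exact mem_span_gramSchmidt ℝ f le_rfl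

open InnerProductSpace in
theorem gramSchmidt_ne_zero_of_lt {E : Type*} [NormedAddCommGroup E]
    [InnerProductSpace ℝ E] {f : ℕ → E} {k i : ℕ}
    (hf : LinearIndependent ℝ fun j : Fin k => f j) (hi : i < k) :
    gramSchmidt ℝ f i ≠ 0 := by
  apply gramSchmidt_ne_zero_coe
  have hinj : Function.Injective
      (fun j : Set.Iic i => (⟨j, lt_of_le_of_lt j.2 hi⟩ : Fin k)) := by
    intro a b h
    exact Subtype.ext (by simpa using h)
  exact hf.comp _ hinj

open InnerProductSpace in
theorem inner_gramSchmidtNormed {E : Type*} [NormedAddCommGroup E]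
    [InnerProductSpace ℝ E] {f : ℕ → E} {k i j : ℕ}
    (hf : LinearIndependent ℝ fun j : Fin k => f j) (hi : i < k) :
    inner ℝ (gramSchmidtNormed ℝ f i) (gramSchmidtNormed ℝ f j) = if i = j then 1 else 0 := by
  split_ifs with h
  · subst h
    have h0 := gramSchmidt_ne_zero_of_lt hf hi
    have : ‖gramSchmidtNormed ℝ f i‖ = 1 :=
      gramSchmidtNormed_unit_length' (by simpa [gramSchmidtNormed] using h0)
    rw [real_inner_self_eq_norm_sq, this, one_pow]
  · simp [gramSchmidtNormed, inner_smul_left, inner_smul_right, gramSchmidt_orthogonal ℝ f h]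

/-- The determinant with rows `g 0, …, g (m - 1), x`, as a linear form in `x`. -/
noncomputable def lastRowDet {m : ℕ} (g : ℕ → EuclideanSpace ℝ (Fin (m + 1)))
    (x : EuclideanSpace ℝ (Fin (m + 1))) : ℝ :=
  Matrix.det (Matrix.of fun a b : Fin (m + 1) => if (a : ℕ) + 1 < m + 1 then g a b else x b)

theorem lastRowDet_eq_sum {m : ℕ} (g : ℕ → EuclideanSpace ℝ (Fin (m + 1)))
    (x : EuclideanSpace ℝ (Fin (m + 1))) :
    lastRowDet g x = ∑ j, x j * lastRowDet g (EuclideanSpace.single j 1) := by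
  have key : ∀ y : EuclideanSpace ℝ (Fin (m + 1)), lastRowDet g y =
      (Matrix.detRowAlternating (R := ℝ)).toMultilinearMap.toLinearMap
        (fun a : Fin (m + 1) => (g a : Fin (m + 1) → ℝ)) (Fin.last m) y := by
    intro y
    change Matrix.det _ = Matrix.det _
    congr 1
    ext a b
    by_cases h : a = Fin.last m
    · subst h; simp
    · have : (a : ℕ) < m := by
        rcases a with ⟨a, ha⟩
        simp [Fin.ext_iff] at h ⊢
        omega
      simp [Function.update_of_ne h, this]
  simp_rw [key]
  have hx : (x : Fin (m + 1) → ℝ) =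
      ∑ j, x j • ((EuclideanSpace.single j (1 : ℝ) : EuclideanSpace ℝ (Fin (m + 1))) :
        Fin (m + 1) → ℝ) := by
    ext i
    simp [Finset.sum_apply, Pi.single_apply]
  conv_lhs => rw [hx]
  rw [map_sum]
  simp

theorem lastRowDet_self {m i : ℕ} (g : ℕ → EuclideanSpace ℝ (Fin (m + 1))) (hi : i < m) :
    lastRowDet g (g i) = 0 := by
  apply Matrix.det_zero_of_row_eq (i := ⟨i, by omega⟩) (j := Fin.last m)
  · simp [Fin.ext_iff]; omega
  · ext b; simp [hi]

theorem Matrix.det_sq_eq_one_of_orthonormal {m : ℕ} {v : Fin m → EuclideanSpace ℝ (Fin m)}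
    (hv : Orthonormal ℝ v) : (Matrix.det (Matrix.of fun a b => v a b)) ^ 2 = 1 := by
  have h : (Matrix.of fun a b => v a b) * (Matrix.of fun a b => v a b).transpose = 1 := by
    ext a b
    rw [Matrix.mul_apply, Matrix.one_apply]
    have := (orthonormal_iff_ite.1 hv) b a
    rw [PiLp.inner_apply] at this
    simpa [eq_comm] using this
  rw [sq]
  nth_rewrite 2 [← Matrix.det_transpose]
  rw [← Matrix.det_mul, h, Matrix.det_one]

theorem exists_norm_eq_one_inner_eq_zero {m : ℕ} (g : ℕ → EuclideanSpace ℝ (Fin (m + 1))) :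
    ∃ u : EuclideanSpace ℝ (Fin (m + 1)), ‖u‖ = 1 ∧ ∀ i < m, inner ℝ (g i) u = 0 := by
  set S := Submodule.span ℝ (Set.range fun j : Fin m => g j)
  have hS : S ≠ ⊤ := by
    intro h
    have h1 : Module.finrank ℝ S ≤ m := by
      have := finrank_range_le_card (R := ℝ) (fun j : Fin m => g j)
      rwa [Fintype.card_fin] at this
    rw [h, finrank_top, finrank_euclideanSpace_fin] at h1
    omega
  have h2 : Sᗮ ≠ ⊥ := fun h => hS (Submodule.orthogonal_eq_bot_iff.1 h)
  obtain ⟨u, hu, hu0⟩ := Submodule.exists_mem_ne_zero_of_ne_bot h2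
  refine ⟨‖u‖⁻¹ • u, by simp [norm_smul, hu0], fun i hi => ?_⟩
  rw [inner_smul_right, (Submodule.mem_orthogonal _ _).1 hu _
    (Submodule.subset_span ⟨⟨i, hi⟩, rfl⟩), mul_zero]

theorem orthonormal_appendLast {m : ℕ} {g : ℕ → EuclideanSpace ℝ (Fin (m + 1))}
    (hg : ∀ i < m, ∀ j < m, inner ℝ (g i) (g j) = if i = j then (1 : ℝ) else 0)
    {u : EuclideanSpace ℝ (Fin (m + 1))} (hu : ‖u‖ = 1) (hgu : ∀ i < m, inner ℝ (g i) u = 0) :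
    Orthonormal ℝ fun j : Fin (m + 1) => if (j : ℕ) + 1 < m + 1 then g j else u := by
  rw [orthonormal_iff_ite]
  intro i j
  simp only [Fin.ext_iff, Nat.add_lt_add_iff_right]
  by_cases hi : (i : ℕ) < m <;> by_cases hj : (j : ℕ) < m
  · simp [hi, hj, hg]
  · have : (i : ℕ) ≠ j := by omega
    simp [hi, hj, hgu, this]
  · have : (i : ℕ) ≠ j := by omega
    have h2 : inner ℝ u (g j) = 0 := by rw [real_inner_comm, hgu _ hj]
    simp [hi, hj, h2, this]
  · have : (i : ℕ) = j := by omega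
    rw [if_neg hi, if_neg hj, if_pos this, real_inner_self_eq_norm_sq, hu, one_pow]

theorem inner_lastRowDet {m : ℕ} (g : ℕ → EuclideanSpace ℝ (Fin (m + 1)))
    (x : EuclideanSpace ℝ (Fin (m + 1))) :
    inner ℝ (WithLp.toLp 2 fun j => lastRowDet g (EuclideanSpace.single j 1)) x =
      lastRowDet g x := by
  rw [lastRowDet_eq_sum, PiLp.inner_apply]
  simp

/-- In an orthonormal basis g 0, …, g (m - 1), u the vector has zero component along each g i, and
its component along u is the determinant of an orthogonal matrix, so ±1. -/
theorem norm_lastRowDet {m : ℕ} {g : ℕ → EuclideanSpace ℝ (Fin (m + 1))}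
    (hg : ∀ i < m, ∀ j < m, inner ℝ (g i) (g j) = if i = j then (1 : ℝ) else 0) :
    ‖(WithLp.toLp 2 fun j => lastRowDet g (EuclideanSpace.single j 1) :
      EuclideanSpace ℝ (Fin (m + 1)))‖ = 1 := by
  obtain ⟨u, hu, hgu⟩ := exists_norm_eq_one_inner_eq_zero g
  have ho := orthonormal_appendLast hg hu hgu
  set w : EuclideanSpace ℝ (Fin (m + 1)) :=
    WithLp.toLp 2 fun j => lastRowDet g (EuclideanSpace.single j 1) with hw
  have hcard : Fintype.card (Fin (m + 1)) =
      Module.finrank ℝ (EuclideanSpace ℝ (Fin (m + 1))) := by simp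
  let b := (basisOfOrthonormalOfCardEqFinrank ho hcard).toOrthonormalBasis (by simpa using ho)
  have hb : ∀ j, b j = if (j : ℕ) + 1 < m + 1 then g j else u := by intro j; simp [b]
  have h1 := b.sum_sq_norm_inner_left w
  rw [Fin.sum_univ_castSucc] at h1
  have h2 : ∀ i : Fin m, inner ℝ w (b i.castSucc) = 0 := by
    intro i
    rw [hb, hw, inner_lastRowDet]
    simp [lastRowDet_self]
  have h3 : inner ℝ w (b (Fin.last m)) = lastRowDet g u := by
    rw [hb, hw, inner_lastRowDet]
    simp
  have h4 : lastRowDet g u ^ 2 = 1 := by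
    have := Matrix.det_sq_eq_one_of_orthonormal ho
    convert this using 4
    unfold lastRowDet
    congr 1
    ext a b
    simp only [Matrix.of_apply]
    split_ifs <;> rfl
  simp only [h2, h3, Real.norm_eq_abs, sq_abs, h4, ne_eq, OfNat.ofNat_ne_zero, not_false_eq_true,
    zero_pow, Finset.sum_const_zero, abs_zero, zero_add] at h1
  nlinarith [norm_nonneg w]

/-! ### The Frenet frame: orthonormality, differentiability and the zero pattern of its derivatives.
-/

theorem frenetVector_of_lt {n : ℕ} (α : ℝ → EuclideanSpace ℝ (Fin n)) {i : ℕ} (hi : i < n)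
    (s : ℝ) : frenetVector α i s =
      InnerProductSpace.gramSchmidtNormed ℝ (fun j : ℕ => iteratedDeriv (j + 1) α s) (i - 1) := by
  simp [frenetVector, hi]

theorem frenetVector_last {m : ℕ} (α : ℝ → EuclideanSpace ℝ (Fin (m + 1))) (s : ℝ) :
    frenetVector α (m + 1) s = WithLp.toLp 2 fun j => lastRowDet
      (fun i => frenetVector α (i + 1) s) (EuclideanSpace.single j 1) := by
  simp only [frenetVector, lt_irrefl, if_false, lastRowDet]
  congr 1
  ext j
  congr 1
  ext a b
  simp only [Matrix.of_apply, PiLp.single_apply]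
  split_ifs <;> simp

theorem frenetVector_orthonormal {n : ℕ} {α : ℝ → EuclideanSpace ℝ (Fin n)} {s : ℝ}
    (h : LinearIndependent ℝ fun j : Fin (n - 1) => iteratedDeriv ((j : ℕ) + 1) α s) :
    Orthonormal ℝ fun j : Fin n => frenetVector α ((j : ℕ) + 1) s := by
  rcases n with _ | m
  · exact ⟨fun i => i.elim0, fun i => i.elim0⟩
  have hg : ∀ i < m, ∀ j < m, inner ℝ (frenetVector α (i + 1) s) (frenetVector α (j + 1) s) =
      if i = j then (1 : ℝ) else 0 := by
    intro i hi j hj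
    rw [frenetVector_of_lt α (by omega), frenetVector_of_lt α (by omega)]
    exact inner_gramSchmidtNormed (f := fun j => iteratedDeriv (j + 1) α s) h hi
  have key := orthonormal_appendLast (g := fun i => frenetVector α (i + 1) s) hg
    (norm_lastRowDet hg) (fun i hi => by
      rw [real_inner_comm, inner_lastRowDet]
      exact lastRowDet_self _ hi)
  convert key using 2 with j
  split_ifs with hj
  · rfl
  · have : (j : ℕ) = m := by omega
    rw [this, frenetVector_last]

theorem inner_frenetVector {n : ℕ} {α : ℝ → EuclideanSpace ℝ (Fin n)} {s : ℝ}
    (h : LinearIndependent ℝ fun j : Fin (n - 1) => iteratedDeriv ((j : ℕ) + 1) α s) {i j : ℕ}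
    (hi : i < n) (hj : j < n) :
    inner ℝ (frenetVector α (i + 1) s) (frenetVector α (j + 1) s) =
      if i = j then (1 : ℝ) else 0 := by
  simpa using orthonormal_iff_ite.1 (frenetVector_orthonormal h) ⟨i, hi⟩ ⟨j, hj⟩

theorem differentiableAt_lastRowDet {m : ℕ} {g : ℝ → ℕ → EuclideanSpace ℝ (Fin (m + 1))} {s : ℝ}
    (hg : ∀ i < m, DifferentiableAt ℝ (fun t => g t i) s) (x : EuclideanSpace ℝ (Fin (m + 1))) :
    DifferentiableAt ℝ (fun t => lastRowDet (g t) x) s := by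
  unfold lastRowDet
  simp only [Matrix.det_apply]
  refine DifferentiableAt.fun_sum fun σ _ => ?_
  refine DifferentiableAt.const_smul ?_ _
  refine DifferentiableAt.fun_finsetProd fun i _ => ?_
  simp only [Matrix.of_apply]
  split_ifs with h
  · exact (differentiableAt_euclidean.1 (hg _ (by omega))) i
  · exact differentiableAt_const _

theorem IsFrenetCurve.differentiableAt_frenetVector {n : ℕ} {α : ℝ → EuclideanSpace ℝ (Fin n)}
    {I : Set ℝ} (hα : IsFrenetCurve α I) (hI : IsOpen I) {s : ℝ} (hs : s ∈ I) {i : ℕ}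
    (hi : i < n) : DifferentiableAt ℝ (frenetVector α (i + 1)) s := by
  have h1 : ∀ j, j + 1 < n → DifferentiableAt ℝ (frenetVector α (j + 1)) s := fun j hj =>
    (hα.differentiableOn (j + 1) (by omega) hj).differentiableAt (hI.mem_nhds hs)
  by_cases h : i + 1 < n
  · exact h1 i h
  obtain rfl : n = i + 1 := by omega
  have : frenetVector α (i + 1) = fun t => WithLp.toLp 2 fun j => lastRowDet
      (fun i => frenetVector α (i + 1) t) (EuclideanSpace.single j 1) :=
    funext fun t => frenetVector_last α t
  rw [this, differentiableAt_euclidean]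
  intro j
  exact differentiableAt_lastRowDet (fun k hk => h1 k (by omega)) _

theorem IsFrenetCurve.differentiableAt_iteratedDeriv {n : ℕ} {α : ℝ → EuclideanSpace ℝ (Fin n)}
    {I : Set ℝ} (hα : IsFrenetCurve α I) (hI : IsOpen I) {s : ℝ} (hs : s ∈ I) {j : ℕ}
    (hj : j + 1 < n) : DifferentiableAt ℝ (iteratedDeriv j α) s := by
  have h1 : DifferentiableOn ℝ (iteratedDerivWithin j α I) I :=
    hα.contDiffOn.differentiableOn_iteratedDerivWithin (by exact_mod_cast (by omega : j < n - 1))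
      hI.uniqueDiffOn
  have h2 := (h1.congr fun x hx => ((iteratedDerivWithin_of_isOpen hI) hx).symm)
  exact h2.differentiableAt (hI.mem_nhds hs)

theorem iteratedDeriv_mem_span_frenetVector {n : ℕ} (α : ℝ → EuclideanSpace ℝ (Fin n)) {j : ℕ}
    (hj : j + 1 < n) (s : ℝ) : iteratedDeriv (j + 1) α s ∈
      Submodule.span ℝ ((fun i => frenetVector α (i + 1) s) '' Set.Iic j) := by
  have h := mem_span_gramSchmidtNormed_image_Iic (fun j => iteratedDeriv (j + 1) α s) j
  refine Submodule.span_mono ?_ h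
  rintro _ ⟨i, hi, rfl⟩
  refine ⟨i, hi, ?_⟩
  have : i ≤ j := hi
  simp only
  rw [frenetVector_of_lt α (by omega)]
  rfl

theorem frenetVector_mem_span_iteratedDeriv {n : ℕ} (α : ℝ → EuclideanSpace ℝ (Fin n)) {j : ℕ}
    (hj : j + 1 < n) (s : ℝ) : frenetVector α (j + 1) s ∈
      Submodule.span ℝ ((fun i => iteratedDeriv (i + 1) α s) '' Set.Iic j) := by
  rw [frenetVector_of_lt α hj]
  exact gramSchmidtNormed_mem_span_image_Iic (fun j => iteratedDeriv (j + 1) α s) j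

theorem inner_eq_zero_of_mem_span_image {E : Type*} [NormedAddCommGroup E]
    [InnerProductSpace ℝ E] {f : ℕ → E} {S : Set ℕ} {x u : E}
    (hx : x ∈ Submodule.span ℝ (f '' S)) (h : ∀ i ∈ S, inner ℝ (f i) u = 0) :
    inner ℝ x u = 0 := by
  induction hx using Submodule.span_induction with
  | mem x hx => obtain ⟨i, hi, rfl⟩ := hx; exact h i hi
  | zero => simp
  | add x y _ _ hx hy => rw [inner_add_left, hx, hy, add_zero]
  | smul a x _ hx => rw [inner_smul_left, hx, mul_zero]

theorem inner_iteratedDeriv_frenetVector_eq_zero {n : ℕ} {α : ℝ → EuclideanSpace ℝ (Fin n)}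
    {s : ℝ} (h : LinearIndependent ℝ fun j : Fin (n - 1) => iteratedDeriv ((j : ℕ) + 1) α s)
    {i j : ℕ} (hij : i < j) (hj : j < n) :
    inner ℝ (iteratedDeriv (i + 1) α s) (frenetVector α (j + 1) s) = 0 := by
  refine inner_eq_zero_of_mem_span_image
    (iteratedDeriv_mem_span_frenetVector α (by omega) s) fun l hl => ?_
  have : l ≤ i := hl
  rw [inner_frenetVector h (by omega) hj, if_neg (by omega)]

theorem inner_deriv_add_inner_deriv {E : Type*} [NormedAddCommGroup E] [InnerProductSpace ℝ E]
    {f g : ℝ → E} {I : Set ℝ} (hI : IsOpen I) {s c : ℝ} (hs : s ∈ I)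
    (hf : DifferentiableAt ℝ f s) (hg : DifferentiableAt ℝ g s)
    (hc : ∀ t ∈ I, inner ℝ (f t) (g t) = c) :
    inner ℝ (f s) (deriv g s) + inner ℝ (deriv f s) (g s) = 0 := by
  have h1 := (hf.hasDerivAt.inner ℝ hg.hasDerivAt)
  have h2 : HasDerivAt (fun t => inner ℝ (f t) (g t)) 0 s :=
    (hasDerivAt_const s c).congr_of_eventuallyEq
      (Filter.eventuallyEq_of_mem (hI.mem_nhds hs) hc)
  exact h1.unique h2

namespace IsFrenetCurve

variable {n : ℕ} {α : ℝ → EuclideanSpace ℝ (Fin n)} {I : Set ℝ}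

theorem inner_deriv_frenetVector_swap (hα : IsFrenetCurve α I) (hI : IsOpen I) {s : ℝ}
    (hs : s ∈ I) {i j : ℕ} (hi : i < n) (hj : j < n) :
    inner ℝ (deriv (frenetVector α (i + 1)) s) (frenetVector α (j + 1) s) =
      -inner ℝ (deriv (frenetVector α (j + 1)) s) (frenetVector α (i + 1) s) := by
  have := inner_deriv_add_inner_deriv hI hs (hα.differentiableAt_frenetVector hI hs hi)
    (hα.differentiableAt_frenetVector hI hs hj)
    (fun t ht => inner_frenetVector (hα.linearIndependent t ht) hi hj)
  rw [real_inner_comm] at this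
  linarith

/-- The vector e_{j+1} is orthogonal to the derivatives of α of orders 1, …, j. Differentiating
these relations for the orders 1, …, i + 1 < j makes e_{j+1}' orthogonal to those derivatives, whose
span contains e_{i+1}; skew-symmetry finishes. Derivatives of α of order above n - 1 never enter. -/
theorem inner_deriv_frenetVector_eq_zero (hα : IsFrenetCurve α I) (hI : IsOpen I) {s : ℝ}
    (hs : s ∈ I) {i j : ℕ} (hij : i + 1 < j) (hj : j < n) :
    inner ℝ (deriv (frenetVector α (i + 1)) s) (frenetVector α (j + 1) s) = 0 := by
  have h1 : ∀ l ∈ Set.Iic i,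
      inner ℝ (iteratedDeriv (l + 1) α s) (deriv (frenetVector α (j + 1)) s) = 0 := by
    intro l hl
    have hl : l ≤ i := hl
    have := inner_deriv_add_inner_deriv hI hs
      (hα.differentiableAt_iteratedDeriv hI hs (j := l + 1) (by omega))
      (hα.differentiableAt_frenetVector hI hs hj) (fun t ht =>
        inner_iteratedDeriv_frenetVector_eq_zero (hα.linearIndependent t ht)
          (i := l) (j := j) (by omega) hj)
    rw [← iteratedDeriv_succ, inner_iteratedDeriv_frenetVector_eq_zero
      (hα.linearIndependent s hs) (by omega) hj, add_zero] at this
    exact this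
  rw [hα.inner_deriv_frenetVector_swap hI hs (by omega) hj, real_inner_comm,
    inner_eq_zero_of_mem_span_image (frenetVector_mem_span_iteratedDeriv α (by omega) s) h1,
    neg_zero]

theorem inner_deriv_frenetVector_self (hα : IsFrenetCurve α I) (hI : IsOpen I) {s : ℝ}
    (hs : s ∈ I) {i : ℕ} (hi : i < n) :
    inner ℝ (deriv (frenetVector α (i + 1)) s) (frenetVector α (i + 1) s) = 0 := by
  have := hα.inner_deriv_frenetVector_swap hI hs hi hi
  linarith

/-- If `e_{i+1}'` is orthogonal to `e_{i+2}`, then so is the derivative of order `i + 2` of `α`. -/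
theorem inner_iteratedDeriv_succ_frenetVector (hα : IsFrenetCurve α I) (hI : IsOpen I) {s : ℝ}
    (hs : s ∈ I) {i : ℕ} (hi : i + 1 < n)
    (hd : DifferentiableAt ℝ (iteratedDeriv (i + 1) α) s)
    (h0 : inner ℝ (deriv (frenetVector α (i + 1)) s) (frenetVector α (i + 2) s) = 0) :
    inner ℝ (iteratedDeriv (i + 2) α s) (frenetVector α (i + 2) s) = 0 := by
  have h1 := inner_deriv_add_inner_deriv hI hs hd
    (hα.differentiableAt_frenetVector hI hs hi) (fun t ht =>
      inner_iteratedDeriv_frenetVector_eq_zero (hα.linearIndependent t ht)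
        (i := i) (j := i + 1) (by omega) hi)
  rw [← iteratedDeriv_succ] at h1
  have h2 : inner ℝ (iteratedDeriv (i + 1) α s) (deriv (frenetVector α (i + 1 + 1)) s) = 0 := by
    refine inner_eq_zero_of_mem_span_image
      (iteratedDeriv_mem_span_frenetVector α hi s) fun l hl => ?_
    have hl : l ≤ i := hl
    rw [real_inner_comm, hα.inner_deriv_frenetVector_swap hI hs hi (by omega), neg_eq_zero]
    rcases hl.lt_or_eq with h | rfl
    · exact hα.inner_deriv_frenetVector_eq_zero hI hs (by omega) hi
    · exact h0
  rw [h2, zero_add] at h1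
  exact h1

theorem deriv_ne_zero (hα : IsFrenetCurve α I) (hn : 2 ≤ n) {s : ℝ} (hs : s ∈ I) :
    deriv α s ≠ 0 := by
  have := (hα.linearIndependent s hs).ne_zero ⟨0, by omega⟩
  simpa using this

theorem curvature_mul_norm (hα : IsFrenetCurve α I) (hn : 2 ≤ n) {s : ℝ} (hs : s ∈ I) (i : ℕ) :
    curvature α i s * ‖deriv α s‖ =
      inner ℝ (deriv (frenetVector α i) s) (frenetVector α (i + 1) s) :=
  div_mul_cancel₀ _ (norm_ne_zero_iff.2 (hα.deriv_ne_zero hn hs))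

end IsFrenetCurve

/-! ### Normal form of a skew operator with a cyclic vector. -/

section SkewNormalForm

variable {E : Type*} [NormedAddCommGroup E] [InnerProductSpace ℝ E]

/-- One eigenvector per eigenvalue, with vanishing components discarded: for a cyclic vector these
components already determine the whole splitting. -/
theorem LinearMap.IsSymmetric.exists_eq_sum_eigenvectors [FiniteDimensional ℝ E] {T : E →ₗ[ℝ] E}
    (hT : T.IsSymmetric) (x : E) :
    ∃ (Λ : Finset ℝ) (v : ℝ → E), (∀ μ ∈ Λ, v μ ≠ 0) ∧ (∀ μ ∈ Λ, T (v μ) = μ • v μ) ∧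
      x = ∑ μ ∈ Λ, v μ := by
  have h1 : (⨆ μ, Module.End.eigenspace T μ) = ⊤ :=
    Submodule.orthogonal_eq_bot_iff.1 hT.orthogonalComplement_iSup_eigenspaces_eq_bot
  obtain ⟨f, hf, hx⟩ := (Submodule.mem_iSup_iff_exists_finsupp _ x).1 (h1 ▸ Submodule.mem_top)
  exact ⟨f.support, f, fun μ hμ => Finsupp.mem_support_iff.1 hμ,
    fun μ _ => Module.End.mem_eigenspace_iff.1 (hf μ), hx.symm⟩

variable {B : E →L[ℝ] E}

theorem inner_apply_self_of_skew (hB : ∀ x y, inner ℝ (B x) y = -inner ℝ x (B y)) (x : E) :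
    inner ℝ x (B x) = 0 := by
  have := hB x x
  rw [real_inner_comm] at this
  linarith

theorem inner_eq_zero_of_apply_apply_eq_smul (hB : ∀ x y, inner ℝ (B x) y = -inner ℝ x (B y))
    {x y : E} {μ ν : ℝ} (hx : B (B x) = μ • x) (hy : B (B y) = ν • y) (h : μ ≠ ν) :
    inner ℝ x y = 0 := by
  have h1 : inner ℝ (B (B x)) y = inner ℝ x (B (B y)) := by rw [hB, hB, neg_neg]
  rw [hx, hy, real_inner_smul_left, real_inner_smul_right] at h1
  have h2 : (μ - ν) * inner ℝ x y = 0 := by linear_combination h1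
  exact (mul_eq_zero.1 h2).resolve_left (sub_ne_zero.2 h)

theorem norm_apply_sq_of_apply_apply_eq_smul (hB : ∀ x y, inner ℝ (B x) y = -inner ℝ x (B y))
    {x : E} {μ : ℝ} (hx : B (B x) = μ • x) : ‖B x‖ ^ 2 = -μ * ‖x‖ ^ 2 := by
  rw [← real_inner_self_eq_norm_sq, hB, hx, real_inner_smul_right, real_inner_self_eq_norm_sq]
  ring

/-- A skew-symmetric operator with a cyclic vector `x` splits into rotations of planes and at most
one fixed line, and `x` has nonzero components in all of these. -/
theorem exists_orthonormalBasis_of_skew [FiniteDimensional ℝ E]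
    (hB : ∀ x y, inner ℝ (B x) y = -inner ℝ x (B y)) {x : E}
    (hx : ∀ S : Submodule ℝ E, x ∈ S → (∀ y ∈ S, B y ∈ S) → S = ⊤) :
    ∃ (P Z : Finset ℝ) (b : OrthonormalBasis ((P × Fin 2) ⊕ Z) ℝ E) (m r : P → ℝ) (a : Z → ℝ),
      Z.card ≤ 1 ∧ (∀ l, m l ≠ 0) ∧ (∀ l, 0 < r l) ∧
      (∀ l, B (b (Sum.inl (l, 0))) = m l • b (Sum.inl (l, 1))) ∧
      (∀ l, B (b (Sum.inl (l, 1))) = -m l • b (Sum.inl (l, 0))) ∧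
      (∀ z, B (b (Sum.inr z)) = 0) ∧
      x = ∑ l, r l • b (Sum.inl (l, 0)) + ∑ z, a z • b (Sum.inr z) := by
  have hT : (B ∘L B : E →L[ℝ] E).toLinearMap.IsSymmetric := by
    intro u w
    simp only [ContinuousLinearMap.coe_coe, ContinuousLinearMap.comp_apply]
    rw [hB, hB, neg_neg]
  obtain ⟨Λ, v, hv0, hv, hsum⟩ := hT.exists_eq_sum_eigenvectors x
  simp only [ContinuousLinearMap.coe_coe, ContinuousLinearMap.comp_apply] at hv
  -- Eigenvalues of B² are at most 0: the negative ones give planes, and 0, if it occurs, the fixed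
  -- line.
  set P := Λ.filter (· ≠ 0) with hP
  set Z := Λ.filter (· = 0) with hZ
  have hPΛ : ∀ l : P, (l : ℝ) ∈ Λ := fun l => (Finset.mem_filter.1 l.2).1
  have hZΛ : ∀ l : Z, (l : ℝ) ∈ Λ := fun l => (Finset.mem_filter.1 l.2).1
  have hP0 : ∀ l : P, (l : ℝ) ≠ 0 := fun l => (Finset.mem_filter.1 l.2).2
  have hZ0 : ∀ l : Z, (l : ℝ) = 0 := fun l => (Finset.mem_filter.1 l.2).2
  have hBv : ∀ μ ∈ Λ, ‖B (v μ)‖ ^ 2 = -μ * ‖v μ‖ ^ 2 := fun μ hμ =>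
    norm_apply_sq_of_apply_apply_eq_smul hB (hv μ hμ)
  have hvpos : ∀ μ ∈ Λ, 0 < ‖v μ‖ := fun μ hμ => norm_pos_iff.2 (hv0 μ hμ)
  have hneg : ∀ l : P, 0 < -(l : ℝ) := by
    intro l
    have h1 := hBv l (hPΛ l)
    have h2 := pow_pos (hvpos l (hPΛ l)) 2
    have h3 : 0 ≤ -(l : ℝ) := by
      by_contra h
      nlinarith [sq_nonneg ‖B (v l)‖]
    exact lt_of_le_of_ne h3 (by simpa [eq_comm] using hP0 l)
  have hBZ : ∀ z : Z, B (v z) = 0 := by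
    intro z
    have h1 := hBv z (hZΛ z)
    rw [hZ0 z] at h1 ⊢
    simpa using h1
  set m : P → ℝ := fun l => Real.sqrt (-(l : ℝ)) with hm
  have hm0 : ∀ l, 0 < m l := fun l => Real.sqrt_pos.2 (hneg l)
  have hm2 : ∀ l, m l ^ 2 = -(l : ℝ) := fun l => Real.sq_sqrt (hneg l).le
  -- For μ = -m² the vectors v μ and B (v μ) are orthogonal with ‖B (v μ)‖ = m ‖v μ‖, so after
  -- normalization B rotates their plane with speed m.
  let w : (P × Fin 2) ⊕ Z → E := Sum.elim
    (fun p => if p.2 = 0 then ‖v p.1‖⁻¹ • v p.1 else (‖v p.1‖⁻¹ * (m p.1)⁻¹) • B (v p.1))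
    (fun z => ‖v z‖⁻¹ • v z)
  have hw0 : ∀ l, w (Sum.inl (l, 0)) = ‖v l‖⁻¹ • v l := fun l => by simp [w]
  have hw1 : ∀ l, w (Sum.inl (l, 1)) = (‖v l‖⁻¹ * (m l)⁻¹) • B (v l) := fun l => by simp [w]
  have hwz : ∀ z, w (Sum.inr z) = ‖v z‖⁻¹ • v z := fun z => rfl
  have hB0 : ∀ l, B (w (Sum.inl (l, 0))) = m l • w (Sum.inl (l, 1)) := by
    intro l
    rw [hw0, hw1, map_smul, smul_smul]
    congr 1
    field_simp [(hm0 l).ne']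
  have hB1 : ∀ l, B (w (Sum.inl (l, 1))) = -m l • w (Sum.inl (l, 0)) := by
    intro l
    rw [hw0, hw1, map_smul, hv _ (hPΛ l), smul_smul, smul_smul]
    congr 1
    have h1 := (hm0 l).ne'
    have h2 : (l : ℝ) = -m l ^ 2 := by rw [hm2, neg_neg]
    rw [h2]
    field_simp
  have hBz : ∀ z, B (w (Sum.inr z)) = 0 := fun z => by rw [hwz, map_smul, hBZ, smul_zero]
  have hBB : ∀ l i, B (B (w (Sum.inl (l, i)))) = (l : ℝ) • w (Sum.inl (l, i)) := by
    intro l i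
    have h2 : (l : ℝ) = -m l ^ 2 := by rw [hm2, neg_neg]
    fin_cases i
    · change B (B (w (Sum.inl (l, 0)))) = (l : ℝ) • w (Sum.inl (l, 0))
      rw [hB0, map_smul, hB1, smul_smul, h2]
      congr 1
      ring
    · change B (B (w (Sum.inl (l, 1)))) = (l : ℝ) • w (Sum.inl (l, 1))
      rw [hB1, map_smul, hB0, smul_smul, h2]
      congr 1
      ring
  have hBBz : ∀ z, B (B (w (Sum.inr z))) = (0 : ℝ) • w (Sum.inr z) := fun z => by
    rw [hBz, map_zero, zero_smul]
  have hortho : Orthonormal ℝ w := by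
    constructor
    · rintro (⟨l, i⟩ | z)
      · fin_cases i
        · change ‖w (Sum.inl (l, 0))‖ = 1
          rw [hw0, norm_smul, norm_inv, norm_norm, inv_mul_cancel₀ (hvpos l (hPΛ l)).ne']
        · change ‖w (Sum.inl (l, 1))‖ = 1
          have h1 : ‖B (v l)‖ = m l * ‖v l‖ := by
            have h2 := hBv l (hPΛ l)
            rw [← hm2, ← mul_pow] at h2
            exact (pow_left_inj₀ (norm_nonneg _)
              (mul_nonneg (hm0 l).le (norm_nonneg _)) two_ne_zero).1 h2
          rw [hw1, norm_smul, h1, norm_mul, norm_inv, norm_norm, norm_inv,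
            Real.norm_of_nonneg (hm0 l).le]
          have := (hvpos l (hPΛ l)).ne'
          have := (hm0 l).ne'
          field_simp
      · rw [hwz, norm_smul, norm_inv, norm_norm, inv_mul_cancel₀ (hvpos z (hZΛ z)).ne']
    · rintro (⟨l, i⟩ | z) (⟨l', i'⟩ | z') hne
      · by_cases hl : l = l'
        · subst hl
          have h1 : inner ℝ (w (Sum.inl (l, 0))) (w (Sum.inl (l, 1))) = 0 := by
            rw [hw0, hw1, real_inner_smul_left, real_inner_smul_right,
              inner_apply_self_of_skew hB]
            ring
          have h2 : i ≠ i' := fun h => hne (by rw [h])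
          fin_cases i <;> fin_cases i'
          · exact absurd rfl h2
          · exact h1
          · exact (real_inner_comm _ _).trans h1
          · exact absurd rfl h2
        · exact inner_eq_zero_of_apply_apply_eq_smul hB (hBB l i) (hBB l' i')
            fun h => hl (Subtype.ext h)
      · exact inner_eq_zero_of_apply_apply_eq_smul hB (hBB l i) (hBBz z') (hP0 l)
      · exact inner_eq_zero_of_apply_apply_eq_smul hB (hBBz z) (hBB l' i') (hP0 l').symm
      · exact absurd (congrArg Sum.inr (Subtype.ext ((hZ0 z).trans (hZ0 z').symm))) hne
  have hxw : x = ∑ l : P, ‖v l‖ • w (Sum.inl (l, 0)) + ∑ z : Z, ‖v z‖ • w (Sum.inr z) := by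
    have h1 : ∀ μ ∈ Λ, ‖v μ‖ • ‖v μ‖⁻¹ • v μ = v μ := fun μ hμ => by
      rw [smul_smul, mul_inv_cancel₀ (hvpos μ hμ).ne', one_smul]
    have h2 : ∑ l : P, ‖v l‖ • w (Sum.inl (l, 0)) = ∑ μ ∈ P, v μ := by
      rw [← Finset.sum_coe_sort P]
      exact Finset.sum_congr rfl fun l _ => by rw [hw0, h1 _ (hPΛ l)]
    have h3 : ∑ z : Z, ‖v z‖ • w (Sum.inr z) = ∑ μ ∈ Z, v μ := by
      rw [← Finset.sum_coe_sort Z]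
      exact Finset.sum_congr rfl fun l _ => by rw [hwz, h1 _ (hZΛ l)]
    rw [h2, h3, hsum, hP, hZ, add_comm]
    exact (Finset.sum_filter_add_sum_filter_not Λ (· = 0) v).symm
  -- The span contains x and is invariant under B, so cyclicity makes it everything.
  have hspan : Submodule.span ℝ (Set.range w) = ⊤ := by
    have hmem : ∀ i, w i ∈ Submodule.span ℝ (Set.range w) := fun i =>
      Submodule.subset_span ⟨i, rfl⟩
    apply hx
    · rw [hxw]
      exact Submodule.add_mem _
        (Submodule.sum_mem _ fun l _ => Submodule.smul_mem _ _ (hmem _))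
        (Submodule.sum_mem _ fun l _ => Submodule.smul_mem _ _ (hmem _))
    · intro y hy
      have hle : Submodule.span ℝ (Set.range w) ≤
          (Submodule.span ℝ (Set.range w)).comap B.toLinearMap := by
        rw [Submodule.span_le]
        rintro _ ⟨⟨l, i⟩ | z, rfl⟩
        · change B _ ∈ Submodule.span ℝ (Set.range w)
          fin_cases i
          · change B (w (Sum.inl (l, 0))) ∈ _
            rw [hB0]
            exact Submodule.smul_mem _ _ (hmem _)
          · change B (w (Sum.inl (l, 1))) ∈ _
            rw [hB1]
            exact Submodule.smul_mem _ _ (hmem _)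
        · change B _ ∈ Submodule.span ℝ (Set.range w)
          rw [hBz]
          exact Submodule.zero_mem _
      exact hle hy
  refine ⟨P, Z, OrthonormalBasis.mk hortho hspan.ge, m, fun l => ‖v l‖, fun z => ‖v z‖, ?_,
    fun l => (hm0 l).ne', fun l => hvpos l (hPΛ l), ?_⟩
  · refine Finset.card_le_one.2 fun a ha b hb => ?_
    rw [(Finset.mem_filter.1 ha).2, (Finset.mem_filter.1 hb).2]
  · simpa only [OrthonormalBasis.coe_mk] using ⟨hB0, hB1, hBz, hxw⟩

end SkewNormalForm

/-! ### Torus geodesics as orbits of infinitesimal rotations. -/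

/-- The infinitesimal rotation of `ℝⁿ` with speeds `m` in the coordinate planes
`(x₀, x₁), (x₂, x₃), …`. -/
noncomputable def torusRotation (n : ℕ) (m : Fin (n / 2) → ℝ) :
    EuclideanSpace ℝ (Fin n) →L[ℝ] EuclideanSpace ℝ (Fin n) :=
  LinearMap.toContinuousLinearMap
    { toFun := fun x => WithLp.toLp 2 fun j : Fin n =>
        if h : (j : ℕ) / 2 < n / 2 then
          if (j : ℕ) % 2 = 0 then -m ⟨(j : ℕ) / 2, h⟩ * x ⟨2 * ((j : ℕ) / 2) + 1, by omega⟩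
          else m ⟨(j : ℕ) / 2, h⟩ * x ⟨2 * ((j : ℕ) / 2), by omega⟩
        else 0
      map_add' := fun x y => by
        ext j
        simp only [PiLp.add_apply]
        split_ifs <;> ring
      map_smul' := fun a x => by
        ext j
        simp only [PiLp.smul_apply, smul_eq_mul, RingHom.id_apply]
        split_ifs <;> ring }

theorem torusRotation_apply {n : ℕ} (m : Fin (n / 2) → ℝ) (x : EuclideanSpace ℝ (Fin n))
    (j : Fin n) : torusRotation n m x j =
      if h : (j : ℕ) / 2 < n / 2 then
        if (j : ℕ) % 2 = 0 then -m ⟨(j : ℕ) / 2, h⟩ * x ⟨2 * ((j : ℕ) / 2) + 1, by omega⟩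
        else m ⟨(j : ℕ) / 2, h⟩ * x ⟨2 * ((j : ℕ) / 2), by omega⟩
      else 0 := rfl

theorem flatTorus_apply {n : ℕ} (r : Fin (n / 2) → ℝ) (a : ℝ) (u : Fin (n / 2) → ℝ) (j : Fin n) :
    flatTorus n r a u j =
    if h : (j : ℕ) / 2 < n / 2 then
      if (j : ℕ) % 2 = 0 then r ⟨(j : ℕ) / 2, h⟩ * Real.cos (u ⟨(j : ℕ) / 2, h⟩)
      else r ⟨(j : ℕ) / 2, h⟩ * Real.sin (u ⟨(j : ℕ) / 2, h⟩)
    else a := rfl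

theorem hasDerivAt_flatTorus {n : ℕ} (r : Fin (n / 2) → ℝ) (a : ℝ) (m : Fin (n / 2) → ℝ) (t : ℝ) :
    HasDerivAt (fun t => flatTorus n r a fun l => m l * t)
      (torusRotation n m (flatTorus n r a fun l => m l * t)) t := by
  suffices h : HasDerivAt (fun t => (flatTorus n r a fun l => m l * t).ofLp)
      (torusRotation n m (flatTorus n r a fun l => m l * t)).ofLp t from
    (PiLp.continuousLinearEquiv 2 ℝ fun _ : Fin n => ℝ).symm.hasFDerivAt.comp_hasDerivAt t h
  rw [hasDerivAt_pi]
  intro j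
  rw [torusRotation_apply]
  simp only [flatTorus_apply]
  have hm : ∀ l, HasDerivAt (fun t => m l * t) (m l) t := fun l => by
    simpa using (hasDerivAt_id t).const_mul (m l)
  by_cases h : (j : ℕ) / 2 < n / 2
  · by_cases h' : (j : ℕ) % 2 = 0
    · have h1 : (2 * ((j : ℕ) / 2) + 1) / 2 = (j : ℕ) / 2 := by omega
      have h2 : ¬ (2 * ((j : ℕ) / 2) + 1) % 2 = 0 := by omega
      simp only [h, h', h1, h2, dif_pos, if_true, if_false]
      refine ((hm _).cos.const_mul _).congr_deriv ?_
      ring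
    · have h1 : (2 * ((j : ℕ) / 2)) / 2 = (j : ℕ) / 2 := by omega
      have h2 : (2 * ((j : ℕ) / 2)) % 2 = 0 := by omega
      simp only [h, h', h1, h2, dif_pos, if_true, if_false]
      refine ((hm _).sin.const_mul _).congr_deriv ?_
      ring
  · simp only [h, dif_neg, not_false_eq_true]
    exact hasDerivAt_const t a

theorem torusRotation_skew {n : ℕ} (m : Fin (n / 2) → ℝ) (x y : EuclideanSpace ℝ (Fin n)) :
    inner ℝ (torusRotation n m x) y = -inner ℝ x (torusRotation n m y) := by
  rw [eq_neg_iff_add_eq_zero, PiLp.inner_apply, PiLp.inner_apply, ← Finset.sum_add_distrib]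
  -- The involution swaps the two coordinates of each plane, whose contributions cancel; it fixes
  -- the leftover coordinate, which contributes 0.
  refine Finset.sum_involution (fun j _ => if h : (j : ℕ) / 2 < n / 2 then
      (if (j : ℕ) % 2 = 0 then ⟨2 * ((j : ℕ) / 2) + 1, by omega⟩ else ⟨2 * ((j : ℕ) / 2), by omega⟩)
      else j) ?_ ?_ (fun _ _ => Finset.mem_univ _) ?_
  · intro j _
    simp only [torusRotation_apply, RCLike.inner_apply, conj_trivial]
    by_cases h : (j : ℕ) / 2 < n / 2
    · by_cases h' : (j : ℕ) % 2 = 0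
      · have h1 : (2 * ((j : ℕ) / 2) + 1) / 2 = (j : ℕ) / 2 := by omega
        have h2 : ¬ (2 * ((j : ℕ) / 2) + 1) % 2 = 0 := by omega
        have h3 : (⟨2 * ((j : ℕ) / 2), by omega⟩ : Fin n) = j := Fin.ext (by simp only; omega)
        simp only [h, h', h1, h2, h3, dif_pos, if_true, if_false]
        ring
      · have h1 : (2 * ((j : ℕ) / 2)) / 2 = (j : ℕ) / 2 := by omega
        have h2 : (2 * ((j : ℕ) / 2)) % 2 = 0 := by omega
        have h3 : (⟨2 * ((j : ℕ) / 2) + 1, by omega⟩ : Fin n) = j := Fin.ext (by simp only; omega)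
        simp only [h, h', h1, h2, h3, dif_pos, if_true, if_false]
        ring
    · simp [h]
  · intro j _ hj
    by_cases h : (j : ℕ) / 2 < n / 2
    · by_cases h' : (j : ℕ) % 2 = 0 <;> simp only [h, h', dif_pos, if_true, if_false, ne_eq,
        Fin.ext_iff] <;> omega
    · simp [torusRotation_apply, h] at hj
  · intro j _
    by_cases h : (j : ℕ) / 2 < n / 2
    · by_cases h' : (j : ℕ) % 2 = 0
      · have h1 : (2 * ((j : ℕ) / 2) + 1) / 2 = (j : ℕ) / 2 := by omega
        have h2 : ¬ (2 * ((j : ℕ) / 2) + 1) % 2 = 0 := by omega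
        simp only [h, h', h1, h2, dif_pos, if_true, if_false, Fin.ext_iff]
        omega
      · have h1 : (2 * ((j : ℕ) / 2)) / 2 = (j : ℕ) / 2 := by omega
        have h2 : (2 * ((j : ℕ) / 2)) % 2 = 0 := by omega
        simp only [h, h', h1, h2, dif_pos, if_true, if_false, Fin.ext_iff]
        omega
    · simp [h]

theorem torusRotation_injective {n : ℕ} (hn : n % 2 = 0) {m : Fin (n / 2) → ℝ}
    (hm : ∀ l, m l ≠ 0) {x : EuclideanSpace ℝ (Fin n)} (hx : torusRotation n m x = 0) :
    x = 0 := by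
  ext j
  have hj := j.2
  have h1 : (j : ℕ) / 2 < n / 2 := by omega
  rcases Nat.mod_two_eq_zero_or_one j with h | h
  · have h2 := congrArg (fun y : EuclideanSpace ℝ (Fin n) => y ⟨j + 1, by omega⟩) hx
    simp only [torusRotation_apply, PiLp.zero_apply] at h2
    rw [dif_pos (by omega), if_neg (by omega)] at h2
    have h3 := (mul_eq_zero.1 h2).resolve_left (hm _)
    simp only [show 2 * (((j : ℕ) + 1) / 2) = j by omega] at h3
    exact h3
  · have h2 := congrArg (fun y : EuclideanSpace ℝ (Fin n) => y ⟨j - 1, by omega⟩) hx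
    simp only [torusRotation_apply, PiLp.zero_apply] at h2
    rw [dif_pos (by omega), if_pos (by omega)] at h2
    have h3 := (mul_eq_zero.1 h2).resolve_left (neg_ne_zero.2 (hm _))
    simp only [show 2 * (((j : ℕ) - 1) / 2) + 1 = j by omega] at h3
    exact h3

/-- Since n = 2|P| + |Z| with |Z| ≤ 1, there are exactly n / 2 planes, and a fixed line exactly when
n is odd. Relabelling the adapted basis gives Ψ. All phases start at 0 because x has no component
along the second vector of any plane. -/
theorem exists_flatTorus_of_skew {n : ℕ}
    {B : EuclideanSpace ℝ (Fin n) →L[ℝ] EuclideanSpace ℝ (Fin n)}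
    (hB : ∀ x y, inner ℝ (B x) y = -inner ℝ x (B y)) {x : EuclideanSpace ℝ (Fin n)}
    (hx : ∀ S : Submodule ℝ (EuclideanSpace ℝ (Fin n)), x ∈ S → (∀ y ∈ S, B y ∈ S) → S = ⊤) :
    ∃ (r : Fin (n / 2) → ℝ) (a : ℝ) (m : Fin (n / 2) → ℝ)
      (Ψ : EuclideanSpace ℝ (Fin n) ≃ₗᵢ[ℝ] EuclideanSpace ℝ (Fin n)),
      (∀ l, 0 < r l) ∧ (∀ l, m l ≠ 0) ∧ Ψ x = (flatTorus n r a fun l => m l * 0) ∧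
      ∀ y, Ψ (B y) = torusRotation n m (Ψ y) := by
  obtain ⟨P, Z, b, m, r, a, hZ, hm, hr, hb0, hb1, hbz, hxb⟩ := exists_orthonormalBasis_of_skew hB hx
  have hcard : n = 2 * P.card + Z.card := by
    have h1 := Module.finrank_eq_card_basis b.toBasis
    rw [finrank_euclideanSpace_fin, Fintype.card_sum, Fintype.card_prod, Fintype.card_coe,
      Fintype.card_coe, Fintype.card_fin] at h1
    omega
  have hP : Fintype.card P = n / 2 := by rw [Fintype.card_coe]; omega
  let σ : Fin (n / 2) ≃ P := (Fintype.equivFinOfCardEq hP).symm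
  have hz : ∀ j : Fin n, ¬ (j : ℕ) / 2 < n / 2 → Nonempty Z := by
    intro j hj
    have := j.2
    rw [← Fintype.card_pos_iff, Fintype.card_coe]
    omega
  let e : Fin n → (P × Fin 2) ⊕ Z := fun j =>
    if h : (j : ℕ) / 2 < n / 2 then
      Sum.inl (σ ⟨(j : ℕ) / 2, h⟩, if (j : ℕ) % 2 = 0 then 0 else 1)
    else Sum.inr (hz j h).some
  have he0 : ∀ (j : Fin n) (h : (j : ℕ) / 2 < n / 2), (j : ℕ) % 2 = 0 →
      e j = Sum.inl (σ ⟨(j : ℕ) / 2, h⟩, 0) := fun j h h' => by simp [e, h, h']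
  have he1 : ∀ (j : Fin n) (h : (j : ℕ) / 2 < n / 2), ¬ (j : ℕ) % 2 = 0 →
      e j = Sum.inl (σ ⟨(j : ℕ) / 2, h⟩, 1) := fun j h h' => by simp [e, h, h']
  have hez : ∀ (j : Fin n) (h : ¬ (j : ℕ) / 2 < n / 2), e j = Sum.inr (hz j h).some :=
    fun j h => by simp only [e, h, dif_neg, not_false_eq_true]
  have hinj : Function.Injective e := by
    intro j j' hjj
    have h1 := j.2
    have h2 := j'.2
    apply Fin.ext
    by_cases h : (j : ℕ) / 2 < n / 2 <;> by_cases h' : (j' : ℕ) / 2 < n / 2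
    · simp only [e, h, h', dif_pos, Sum.inl.injEq, Prod.mk.injEq, EmbeddingLike.apply_eq_iff_eq,
        Fin.mk.injEq] at hjj
      obtain ⟨h3, h4⟩ := hjj
      split_ifs at h4 <;> omega
    · simp [e, h, h'] at hjj
    · simp [e, h, h'] at hjj
    · omega
  have hbij : Function.Bijective e := by
    rw [Fintype.bijective_iff_injective_and_card]
    refine ⟨hinj, ?_⟩
    rw [Fintype.card_sum, Fintype.card_prod, Fintype.card_coe, Fintype.card_coe, Fintype.card_fin,
      Fintype.card_fin]
    omega
  let b' := b.reindex (Equiv.ofBijective e hbij).symm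
  have hb' : ∀ j, b' j = b (e j) := fun j => by simp [b']
  have hb'x : ∀ y j, b'.repr y j = inner ℝ (b (e j)) y := fun y j => by
    rw [OrthonormalBasis.repr_apply_apply, hb']
  have hbb : ∀ i j, inner ℝ (b i) (b j) = if i = j then (1 : ℝ) else 0 :=
    orthonormal_iff_ite.1 b.orthonormal
  -- The sum over Z has at most one term: the constant last coordinate for odd n, and 0 for even n.
  refine ⟨fun l => r (σ l), ∑ z, a z, fun l => m (σ l), b'.repr, fun l => hr _, fun l => hm _,
    ?_, fun y => ?_⟩
  · ext j
    rw [hb'x, flatTorus_apply, hxb]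
    simp only [inner_add_right, inner_sum, inner_smul_right, mul_zero, Real.cos_zero,
      Real.sin_zero, mul_one, hbb]
    split_ifs with h h'
    · rw [he0 j h h']; simp
    · rw [he1 j h h']; simp
    · rw [hez j h]
      have : ∀ z : Z, (hz j h).some = z := fun z =>
        Subtype.ext (Finset.card_le_one.1 hZ _ (hz j h).some.2 _ z.2)
      have hu : (Finset.univ : Finset Z) = {(hz j h).some} := by
        ext z
        simp [this z]
      rw [hu]
      simp
  · ext j
    rw [hb'x, torusRotation_apply]
    have h1 : inner ℝ (b (e j)) (B y) = -inner ℝ (B (b (e j))) y := by rw [hB, neg_neg]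
    rw [h1]
    split_ifs with h h'
    · rw [hb'x, he0 j h h', hb0, inner_smul_left, he1 _ (by simp only; omega) (by simp only; omega)]
      simp only [show (2 * ((j : ℕ) / 2) + 1) / 2 = (j : ℕ) / 2 by omega]
      simp
    · rw [hb'x, he1 j h h', hb1, inner_smul_left, he0 _ (by simp only; omega) (by simp)]
      simp only [show (2 * ((j : ℕ) / 2)) / 2 = (j : ℕ) / 2 by omega]
      simp
    · rw [hez j h, hbz, inner_zero_left, neg_zero]

/-! ### Orbits of skew operators as twisted Frenet curves. -/

open InnerProductSpace in
theorem differentiableAt_gramSchmidt {E : Type*} [NormedAddCommGroup E] [InnerProductSpace ℝ E]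
    {f : ℝ → ℕ → E} {s : ℝ} {k : ℕ} (hf : ∀ j < k, DifferentiableAt ℝ (fun t => f t j) s)
    (hli : LinearIndependent ℝ fun j : Fin k => f s j) {i : ℕ} (hi : i < k) :
    DifferentiableAt ℝ (fun t => gramSchmidt ℝ (f t) i) s := by
  induction i using Nat.strong_induction_on with
  | _ i ih =>
    have h0 : (fun t => gramSchmidt ℝ (f t) i) = fun t => f t i -
        ∑ j ∈ Finset.Iio i, (ℝ ∙ gramSchmidt ℝ (f t) j).starProjection (f t i) :=
      funext fun t => gramSchmidt_def ℝ (f t) i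
    rw [h0]
    refine (hf i hi).sub (DifferentiableAt.fun_sum fun j hj => ?_)
    have hj' : j < i := Finset.mem_Iio.1 hj
    have h1 := ih j hj' (hj'.trans hi)
    simp_rw [Submodule.starProjection_singleton]
    refine DifferentiableAt.smul (DifferentiableAt.div (h1.inner ℝ (hf i hi)) ?_ ?_) h1
    · simpa using h1.norm_sq ℝ
    · simpa using gramSchmidt_ne_zero_of_lt hli (hj'.trans hi)

open InnerProductSpace in
theorem differentiableAt_gramSchmidtNormed {E : Type*} [NormedAddCommGroup E]
    [InnerProductSpace ℝ E] {f : ℝ → ℕ → E} {s : ℝ} {k : ℕ}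
    (hf : ∀ j < k, DifferentiableAt ℝ (fun t => f t j) s)
    (hli : LinearIndependent ℝ fun j : Fin k => f s j) {i : ℕ} (hi : i < k) :
    DifferentiableAt ℝ (fun t => gramSchmidtNormed ℝ (f t) i) s := by
  have h1 := differentiableAt_gramSchmidt hf hli hi
  have h0 := gramSchmidt_ne_zero_of_lt hli hi
  unfold gramSchmidtNormed
  refine DifferentiableAt.smul (DifferentiableAt.inv ?_ ?_) h1
  · simpa using h1.norm ℝ h0
  · simpa using h0

section SkewFlow

variable {E : Type*} [NormedAddCommGroup E] [InnerProductSpace ℝ E] {C : E →L[ℝ] E} {γ : ℝ → E}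

theorem HasDerivAt.clm_pow_apply (hγ : ∀ t, HasDerivAt γ (C (γ t)) t) (j : ℕ) (t : ℝ) :
    HasDerivAt (fun t => (C ^ j) (γ t)) ((C ^ (j + 1)) (γ t)) t :=
  (C ^ j).hasFDerivAt.comp_hasDerivAt t (hγ t)

theorem iteratedDeriv_eq_clm_pow (hγ : ∀ t, HasDerivAt γ (C (γ t)) t) (j : ℕ) :
    iteratedDeriv j γ = fun t => (C ^ j) (γ t) := by
  induction j with
  | zero => ext; simp
  | succ j ih =>
    rw [iteratedDeriv_succ, ih]
    exact funext fun t => (HasDerivAt.clm_pow_apply hγ j t).deriv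

/-- The derivative in t is ⟨C^{i+1}γ, C^jγ⟩ + ⟨C^iγ, C^{j+1}γ⟩, which vanishes because C is skew. -/
theorem inner_clm_pow_apply_eq (hγ : ∀ t, HasDerivAt γ (C (γ t)) t)
    (hC : ∀ x y, inner ℝ (C x) y = -inner ℝ x (C y)) (i j : ℕ) (t t' : ℝ) :
    inner ℝ ((C ^ i) (γ t)) ((C ^ j) (γ t)) = inner ℝ ((C ^ i) (γ t')) ((C ^ j) (γ t')) := by
  have h : ∀ t, HasDerivAt (fun t => inner ℝ ((C ^ i) (γ t)) ((C ^ j) (γ t))) 0 t := by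
    intro t
    refine ((HasDerivAt.clm_pow_apply hγ i t).inner ℝ
      (HasDerivAt.clm_pow_apply hγ j t)).congr_deriv ?_
    rw [pow_succ', pow_succ', mul_apply_eq_comp, mul_apply_eq_comp, hC]
    ring
  exact is_const_of_deriv_eq_zero (fun t => (h t).differentiableAt) (fun t => (h t).deriv) t t'

/-- Independence depends only on the Gram matrix, which is the same at t and t'. -/
theorem linearIndependent_clm_pow_apply (hγ : ∀ t, HasDerivAt γ (C (γ t)) t)
    (hC : ∀ x y, inner ℝ (C x) y = -inner ℝ x (C y)) {k : ℕ} {t t' : ℝ}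
    (h : LinearIndependent ℝ fun j : Fin k => (C ^ (j : ℕ)) (γ t)) :
    LinearIndependent ℝ fun j : Fin k => (C ^ (j : ℕ)) (γ t') := by
  rw [Fintype.linearIndependent_iff] at h ⊢
  intro g hg
  apply h g
  rw [← inner_self_eq_zero (𝕜 := ℝ)] at hg ⊢
  rw [← hg]
  simp only [sum_inner, inner_sum, inner_smul_left, inner_smul_right,
    inner_clm_pow_apply_eq hγ hC _ _ t t']

theorem contDiff_of_hasDerivAt_clm (hγ : ∀ t, HasDerivAt γ (C (γ t)) t) (k : ℕ) :
    ContDiff ℝ k γ := by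
  refine contDiff_of_differentiable_iteratedDeriv (n := k) fun m _ => ?_
  rw [iteratedDeriv_eq_clm_pow hγ]
  exact fun t => (HasDerivAt.clm_pow_apply hγ m t).differentiableAt

/-- Row i expresses B (b i) through b 0, …, b (i + 1) with nonzero last coefficient, so it can be
solved for b (i + 1). -/
theorem mem_span_clm_pow_of_tridiagonal {n : ℕ} {B : E →L[ℝ] E} {b : ℕ → E} {A : ℕ → ℕ → ℝ}
    (hB : ∀ i < n, B (b i) = ∑ j ∈ Finset.range n, A i j • b j)
    (hA : ∀ i j, i + 1 < j → j < n → A i j = 0) (hA' : ∀ i, i + 1 < n → A i (i + 1) ≠ 0)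
    {i : ℕ} (hi : i < n) : b i ∈ Submodule.span ℝ ((fun j => (B ^ j) (b 0)) '' Set.Iic i) := by
  induction i using Nat.strong_induction_on with
  | _ i ih =>
    rcases i with _ | i
    · exact Submodule.subset_span ⟨0, by simp, by simp⟩
    have h1 : ∀ j ≤ i, b j ∈ Submodule.span ℝ ((fun j => (B ^ j) (b 0)) '' Set.Iic (i + 1)) :=
      fun j hj => Submodule.span_mono (Set.image_mono (Set.Iic_subset_Iic.2 (by omega)))
        (ih j (by omega) (by omega))
    have h2 : B (b i) ∈ Submodule.span ℝ ((fun j => (B ^ j) (b 0)) '' Set.Iic (i + 1)) := by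
      have hle : Submodule.span ℝ ((fun j => (B ^ j) (b 0)) '' Set.Iic i) ≤
          (Submodule.span ℝ ((fun j => (B ^ j) (b 0)) '' Set.Iic (i + 1))).comap
            B.toLinearMap := by
        rw [Submodule.span_le]
        rintro _ ⟨j, hj, rfl⟩
        refine Submodule.subset_span ⟨j + 1, ?_, ?_⟩
        · have : j ≤ i := hj
          simpa using this
        · simp [pow_succ']
      exact hle (ih i (by omega) (by omega))
    have h3 : A i (i + 1) • b (i + 1) = B (b i) - ∑ j ∈ Finset.range (i + 1), A i j • b j := by
      rw [hB i (by omega), ← Finset.sum_subset (Finset.range_mono (show i + 2 ≤ n by omega)),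
        Finset.sum_range_succ]
      · abel
      · intro j hj hj'
        rw [hA i j (by simp at hj'; omega) (by simpa using hj), zero_smul]
    rw [← inv_smul_smul₀ (hA' i hi) (b (i + 1)), h3]
    exact Submodule.smul_mem _ _ (Submodule.sub_mem _ h2
      (Submodule.sum_mem _ fun j hj => Submodule.smul_mem _ _
        (h1 j (by simp at hj; omega))))

end SkewFlow

theorem isFrenetCurve_of_clm {n : ℕ} {γ : ℝ → EuclideanSpace ℝ (Fin n)}
    {C : EuclideanSpace ℝ (Fin n) →L[ℝ] EuclideanSpace ℝ (Fin n)}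
    (hγ : ∀ t, HasDerivAt γ (C (γ t)) t)
    (hli : ∀ t, LinearIndependent ℝ fun j : Fin n => (C ^ (j : ℕ)) (γ t)) :
    IsFrenetCurve γ Set.univ := by
  have hli' : ∀ t, LinearIndependent ℝ fun j : Fin (n - 1) => iteratedDeriv ((j : ℕ) + 1) γ t := by
    intro t
    have hinj : Function.Injective (fun j : Fin (n - 1) => (⟨j + 1, by omega⟩ : Fin n)) := by
      intro i j h
      simpa [Fin.ext_iff] using h
    simpa only [iteratedDeriv_eq_clm_pow hγ, Function.comp_def] using (hli t).comp _ hinj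
  refine ⟨(contDiff_of_hasDerivAt_clm hγ _).contDiffOn, fun t _ => hli' t, fun i h1 hi t _ => ?_⟩
  have hd : ∀ j < n - 1, DifferentiableAt ℝ (fun t => iteratedDeriv (j + 1) γ t) t := by
    intro j _
    rw [iteratedDeriv_eq_clm_pow hγ]
    exact (HasDerivAt.clm_pow_apply hγ _ t).differentiableAt
  have h2 : frenetVector γ i = fun t => InnerProductSpace.gramSchmidtNormed ℝ
      (fun j : ℕ => iteratedDeriv (j + 1) γ t) (i - 1) :=
    funext fun t => frenetVector_of_lt γ hi t
  have h3 : DifferentiableAt ℝ (frenetVector γ i) t := by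
    rw [h2]
    exact differentiableAt_gramSchmidtNormed (f := fun t j => iteratedDeriv (j + 1) γ t) (s := t)
      (k := n - 1) (i := i - 1) hd (hli' t) (by omega)
  exact h3.differentiableWithinAt

/-- Let k = n / 2. If k_{2k-1} vanished, e_{2k} would be orthogonal to γ', …, γ^{(2k)}. For odd n it
lies in their span, so it would be 0. For even n these derivatives are the images under C of the
basis γ, …, C^{n-1}γ, so C e_n = 0, and injectivity of C gives e_n = 0. Either way a unit vector
would vanish. -/
theorem curvature_ne_zero_of_clm {n : ℕ} (hn : 2 ≤ n) {γ : ℝ → EuclideanSpace ℝ (Fin n)}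
    {C : EuclideanSpace ℝ (Fin n) →L[ℝ] EuclideanSpace ℝ (Fin n)}
    (hC : ∀ x y, inner ℝ (C x) y = -inner ℝ x (C y))
    (hinj : n % 2 = 0 → ∀ x, C x = 0 → x = 0)
    (hγ : ∀ t, HasDerivAt γ (C (γ t)) t)
    (hli : ∀ t, LinearIndependent ℝ fun j : Fin n => (C ^ (j : ℕ)) (γ t)) (t : ℝ) :
    curvature γ (2 * (n / 2) - 1) t ≠ 0 := by
  have hF := isFrenetCurve_of_clm hγ hli
  obtain ⟨i, hi⟩ : ∃ i, 2 * (n / 2) - 1 = i + 1 := ⟨2 * (n / 2) - 2, by omega⟩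
  rw [hi]
  intro h0
  have h1 : inner ℝ (deriv (frenetVector γ (i + 1)) t) (frenetVector γ (i + 2) t) = 0 := by
    rw [← hF.curvature_mul_norm hn (Set.mem_univ t), h0, zero_mul]
  have h2 := hF.inner_iteratedDeriv_succ_frenetVector isOpen_univ (Set.mem_univ t)
    (show i + 1 < n by omega) (by
      rw [iteratedDeriv_eq_clm_pow hγ]
      exact (HasDerivAt.clm_pow_apply hγ _ t).differentiableAt) h1
  have h3 : ∀ j ≤ i + 1, inner ℝ (iteratedDeriv (j + 1) γ t) (frenetVector γ (i + 2) t) = 0 := by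
    intro j hj
    rcases hj.lt_or_eq with h | rfl
    · exact inner_iteratedDeriv_frenetVector_eq_zero (hF.linearIndependent t (Set.mem_univ t))
        h (by omega)
    · exact h2
  have hne : frenetVector γ (i + 2) t ≠ 0 := by
    intro h
    have := inner_frenetVector (hF.linearIndependent t (Set.mem_univ t)) (i := i + 1) (j := i + 1)
      (by omega) (by omega)
    rw [h, inner_zero_left, if_pos rfl] at this
    exact zero_ne_one this
  rcases Nat.mod_two_eq_zero_or_one n with hn2 | hn2
  · apply hne
    apply hinj hn2
    have hspan : Submodule.span ℝ (Set.range fun j : Fin n => (C ^ (j : ℕ)) (γ t)) = ⊤ :=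
      (hli t).span_eq_top_of_card_eq_finrank' (by simp)
    have hall : ∀ x, inner ℝ x (C (frenetVector γ (i + 2) t)) = 0 := by
      intro x
      have hx : x ∈ Submodule.span ℝ (Set.range fun j : Fin n => (C ^ (j : ℕ)) (γ t)) :=
        hspan ▸ Submodule.mem_top
      induction hx using Submodule.span_induction with
      | mem x hx =>
        obtain ⟨j, rfl⟩ := hx
        have h4 := h3 j (by omega)
        rw [iteratedDeriv_eq_clm_pow hγ, pow_succ'] at h4
        have h5 := hC ((C ^ (j : ℕ)) (γ t)) (frenetVector γ (i + 2) t)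
        simp only [mul_apply_eq_comp] at h4 ⊢
        linarith
      | zero => simp
      | add x y _ _ hx hy => rw [inner_add_left, hx, hy, add_zero]
      | smul a x _ hx => rw [inner_smul_left, hx, mul_zero]
    exact inner_self_eq_zero.1 (hall _)
  · exact hne (inner_self_eq_zero.1 (inner_eq_zero_of_mem_span_image
      (frenetVector_mem_span_iteratedDeriv γ (j := i + 1) (by omega) t) fun j hj => h3 j hj))

/-! ### The parameter t(s) as a primitive of k_1 ‖α'‖. -/

/-- A nowhere vanishing function which locally has primitives is integrable on compact
intervals, because it has constant sign, and its integral is a primitive. -/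
theorem hasDerivAt_integral_of_local_primitive {κ : ℝ → ℝ} {I : Set ℝ} (hIopen : IsOpen I)
    (hIconn : I.OrdConnected) (hne : ∀ s ∈ I, κ s ≠ 0)
    (hloc : ∀ s ∈ I, ∃ θ : ℝ → ℝ, ∀ᶠ x in nhds s, HasDerivAt θ (κ x) x) {s₀ s : ℝ}
    (hs₀ : s₀ ∈ I) (hs : s ∈ I) :
    HasDerivAt (fun s => ∫ u in s₀..s, κ u) (κ s) s := by
  have hloc' : ∀ s ∈ I, ∃ θ : ℝ → ℝ, ∃ ε > 0,
      ∀ x ∈ Metric.ball s ε, HasDerivAt θ (κ x) x ∧ x ∈ I := by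
    intro s hs
    obtain ⟨θ, hθ⟩ := hloc s hs
    obtain ⟨ε, hε, h⟩ := Metric.eventually_nhds_iff_ball.1 (hθ.and (hIopen.mem_nhds hs))
    exact ⟨θ, ε, hε, h⟩
  have hint : ∀ s ∈ I, ∀ θ : ℝ → ℝ, ∀ ε > 0,
      (∀ x ∈ Metric.ball s ε, HasDerivAt θ (κ x) x ∧ x ∈ I) →
      ∀ a ∈ Metric.ball s ε, ∀ b ∈ Metric.ball s ε,
        IntervalIntegrable κ MeasureTheory.volume a b := by
    intro s _ θ ε _ h a ha b hb
    have hconv : Convex ℝ (Metric.ball s ε) := convex_ball s ε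
    have hsub : Set.uIcc a b ⊆ Metric.ball s ε := hconv.ordConnected.uIcc_subset ha hb
    have hsub' : Set.Ioo (min a b) (max a b) ⊆ Metric.ball s ε :=
      Set.Ioo_subset_Icc_self.trans hsub
    -- By Darboux's theorem κ has constant sign on the ball, and a derivative of constant sign is
    -- integrable.
    rcases hasDerivWithinAt_forall_lt_or_forall_gt_of_forall_ne hconv
      (fun x hx => (h x hx).1.hasDerivWithinAt) (m := 0) (fun x hx => hne x (h x hx).2) with h1 | h1
    · have := intervalIntegral.intervalIntegrable_deriv_of_nonneg (g := fun x => -θ x)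
        (g' := fun x => -κ x) (a := a) (b := b)
        (fun x hx => (h x (hsub hx)).1.neg.continuousAt.continuousWithinAt)
        (fun x hx => (h x (hsub' hx)).1.neg)
        (fun x hx => neg_nonneg.2 (h1 x (hsub' hx)).le)
      exact this.neg.congr (fun x _ => neg_neg (κ x))
    · exact intervalIntegral.intervalIntegrable_deriv_of_nonneg (g := θ)
        (fun x hx => (h x (hsub hx)).1.continuousAt.continuousWithinAt)
        (fun x hx => (h x (hsub' hx)).1) (fun x hx => (h1 x (hsub' hx)).le)
  have hLI : MeasureTheory.LocallyIntegrableOn κ I := by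
    intro x hx
    obtain ⟨θ, ε, hε, h⟩ := hloc' x hx
    have hmem : ∀ c, |c| < ε → x + c ∈ Metric.ball x ε := fun c hc => by
      simpa [Real.dist_eq] using hc
    have h1 := hint x hx θ ε hε h (x + -(ε / 2)) (hmem _ (by rw [abs_neg, abs_of_pos] <;> linarith))
      (x + ε / 2) (hmem _ (by rw [abs_of_pos] <;> linarith))
    refine ⟨Set.Ioc (x + -(ε / 2)) (x + ε / 2), mem_nhdsWithin_of_mem_nhds
      (Ioc_mem_nhds (by linarith) (by linarith)), ?_⟩
    exact (intervalIntegrable_iff_integrableOn_Ioc_of_le (by linarith)).1 h1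
  have hint₀ : IntervalIntegrable κ MeasureTheory.volume s₀ s := by
    have h1 : MeasureTheory.IntegrableOn κ (Set.uIcc s₀ s) :=
      hLI.integrableOn_compact_subset (hIconn.uIcc_subset hs₀ hs) isCompact_uIcc
    exact h1.intervalIntegrable
  obtain ⟨θ, ε, hε, h⟩ := hloc' s hs
  have hev : (fun x => ∫ u in s₀..x, κ u) =ᶠ[nhds s]
      fun x => (∫ u in s₀..s, κ u) + (θ x - θ s) := by
    filter_upwards [Metric.ball_mem_nhds s hε] with x hx
    have hss := Metric.mem_ball_self (x := s) hε
    have h1 := hint s hs θ ε hε h s hss x hx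
    have hsub : Set.uIcc s x ⊆ Metric.ball s ε :=
      (convex_ball s ε).ordConnected.uIcc_subset hss hx
    rw [← intervalIntegral.integral_add_adjacent_intervals hint₀ h1,
      intervalIntegral.integral_eq_sub_of_hasDerivAt (fun y hy => (h y (hsub hy)).1) h1]
  refine HasDerivAt.congr_of_eventuallyEq ?_ hev
  exact ((h s (Metric.mem_ball_self hε)).1.sub_const _).const_add _

theorem hasDerivAt_integral_of_continuousOn {κ : ℝ → ℝ} {I : Set ℝ} (hIopen : IsOpen I)
    (hIconn : I.OrdConnected) (hκ : ContinuousOn κ I) {s₀ s : ℝ} (hs₀ : s₀ ∈ I) (hs : s ∈ I) :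
    HasDerivAt (fun s => ∫ u in s₀..s, κ u) (κ s) s :=
  intervalIntegral.integral_hasDerivAt_right
    (hκ.mono (hIconn.uIcc_subset hs₀ hs)).intervalIntegrable
    (hκ.stronglyMeasurableAtFilter hIopen s hs) (hκ.continuousAt (hIopen.mem_nhds hs))

theorem eq_sum_inner_frenetVector {n : ℕ} {α : ℝ → EuclideanSpace ℝ (Fin n)} {s : ℝ}
    (h : LinearIndependent ℝ fun j : Fin (n - 1) => iteratedDeriv ((j : ℕ) + 1) α s)
    (x : EuclideanSpace ℝ (Fin n)) :
    x = ∑ j : Fin n, inner ℝ x (frenetVector α (j + 1) s) • frenetVector α (j + 1) s := by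
  have ho := frenetVector_orthonormal h
  let b := OrthonormalBasis.mk ho
    (ho.linearIndependent.span_eq_top_of_card_eq_finrank' (by simp)).ge
  have hb : ∀ j, b j = frenetVector α (j + 1) s := by intro j; simp [b]
  conv_lhs => rw [← b.sum_repr' x]
  simp only [hb, real_inner_comm]

namespace IsFrenetCurve

variable {n : ℕ} {α : ℝ → EuclideanSpace ℝ (Fin n)} {I : Set ℝ}

/-- The Frenet equation for e_{i+1}. It needs no separate form at i = 0: truncated subtraction makes
`frenetVector α 0` equal to e_1, so the second term is ⟨e_1', e_1⟩ e_1 = 0. -/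
theorem deriv_frenetVector_eq_sum (hα : IsFrenetCurve α I) (hI : IsOpen I) {s : ℝ} (hs : s ∈ I)
    {i : ℕ} (hi : i + 1 < n) :
    deriv (frenetVector α (i + 1)) s =
      inner ℝ (deriv (frenetVector α (i + 1)) s) (frenetVector α (i + 2) s) •
        frenetVector α (i + 2) s +
      inner ℝ (deriv (frenetVector α (i + 1)) s) (frenetVector α i s) • frenetVector α i s := by
  conv_lhs => rw [eq_sum_inner_frenetVector (hα.linearIndependent s hs)
    (deriv (frenetVector α (i + 1)) s)]
  rcases i with _ | i
  · have h0 : frenetVector α 0 s = frenetVector α 1 s := by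
      rw [frenetVector_of_lt α (by omega), frenetVector_of_lt α hi]
    rw [h0, hα.inner_deriv_frenetVector_self hI hs (i := 0) (by omega), zero_smul, add_zero]
    refine Finset.sum_eq_single (⟨1, hi⟩ : Fin n) (fun j _ hj => ?_) (fun h => by simp at h)
    have hj' : (j : ℕ) ≠ 1 := fun h => hj (Fin.ext h)
    rcases Nat.lt_or_ge (j : ℕ) 1 with h | h
    · have h1 : (j : ℕ) = 0 := by omega
      rw [h1, hα.inner_deriv_frenetVector_self hI hs (i := 0) (by omega), zero_smul]
    · rw [hα.inner_deriv_frenetVector_eq_zero hI hs (i := 0) (by omega) j.2, zero_smul]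
  · refine Finset.sum_eq_add (⟨i + 2, hi⟩ : Fin n) ⟨i, by omega⟩ (by simp)
      (fun j _ hj => ?_) (fun h => by simp at h) (fun h => by simp at h)
    have hj1 : (j : ℕ) ≠ i + 2 := fun h => hj.1 (Fin.ext h)
    have hj2 : (j : ℕ) ≠ i := fun h => hj.2 (Fin.ext h)
    rcases lt_trichotomy (j : ℕ) (i + 1) with h | h | h
    · rw [hα.inner_deriv_frenetVector_swap hI hs (by omega) j.2,
        hα.inner_deriv_frenetVector_eq_zero hI hs (by omega) (by omega), neg_zero, zero_smul]
    · rw [h, hα.inner_deriv_frenetVector_self hI hs (by omega), zero_smul]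
    · rw [hα.inner_deriv_frenetVector_eq_zero hI hs (by omega) j.2, zero_smul]

theorem deriv_frenetVector_one (hα : IsFrenetCurve α I) (hn : 2 ≤ n) (hI : IsOpen I) {s : ℝ}
    (hs : s ∈ I) : deriv (frenetVector α 1) s =
      (curvature α 1 s * ‖deriv α s‖) • frenetVector α 2 s := by
  have h0 : frenetVector α 0 s = frenetVector α 1 s := by
    rw [frenetVector_of_lt α (by omega), frenetVector_of_lt α (by omega)]
  have := hα.deriv_frenetVector_eq_sum hI hs (i := 0) (by omega)
  rw [h0, hα.inner_deriv_frenetVector_self hI hs (i := 0) (by omega), zero_smul, add_zero] at this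
  rw [hα.curvature_mul_norm hn hs]
  exact this

/-- For n ≥ 3 the curve is C², so e_1 is C¹ and ⟨e_1', e_2⟩ is continuous. -/
theorem continuousOn_curvature_one_mul_norm (hα : IsFrenetCurve α I) (hn : 3 ≤ n)
    (hI : IsOpen I) : ContinuousOn (fun s => curvature α 1 s * ‖deriv α s‖) I := by
  have h1 : ContDiffOn ℝ 1 (deriv α) I := by
    have h2 : ContDiffOn ℝ (1 + 1) α I := hα.contDiffOn.of_le (by
      norm_cast
      omega)
    exact ((contDiffOn_succ_iff_deriv_of_isOpen hI).1 h2).2.2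
  have h3 : ContDiffOn ℝ 1 (frenetVector α 1) I := by
    have h4 : frenetVector α 1 = fun s => ‖deriv α s‖⁻¹ • deriv α s := by
      ext1 s
      rw [frenetVector_of_lt α (by omega), InnerProductSpace.gramSchmidtNormed,
        InnerProductSpace.gramSchmidt_def]
      simp
    rw [h4]
    exact ((h1.norm ℝ fun s hs => hα.deriv_ne_zero (by omega) hs).inv fun s hs =>
      norm_ne_zero_iff.2 (hα.deriv_ne_zero (by omega) hs)).smul h1
  have h5 : ContinuousOn (fun s => inner ℝ (deriv (frenetVector α 1) s) (frenetVector α 2 s)) I :=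
    (h3.continuousOn_deriv_of_isOpen hI le_rfl).inner fun s hs =>
      (hα.differentiableAt_frenetVector hI hs (i := 1) (by omega)).continuousAt.continuousWithinAt
  exact h5.congr fun s hs => hα.curvature_mul_norm (by omega) hs 1

/-- Near s write e_1 = cos θ e_1(s) + sin θ e_2(s). Then (sin θ)' = k_1 ‖α'‖ ⟨e_2, e_2(s)⟩ = k_1
‖α'‖ cos θ with cos θ > 0, so θ' = k_1 ‖α'‖. Continuity of e_1' is not needed. -/
theorem exists_angle {α : ℝ → EuclideanSpace ℝ (Fin 2)} (hα : IsFrenetCurve α I) (hI : IsOpen I)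
    {s : ℝ} (hs : s ∈ I) : ∃ θ : ℝ → ℝ, ∀ᶠ x in nhds s,
      HasDerivAt θ (curvature α 1 x * ‖deriv α x‖) x := by
  refine ⟨fun x => Real.arcsin (inner ℝ (frenetVector α 1 x) (frenetVector α 2 s)), ?_⟩
  have hc : ContinuousAt (fun x => inner ℝ (frenetVector α 2 x) (frenetVector α 2 s)) s :=
    (hα.differentiableAt_frenetVector hI hs (i := 1) (by omega)).continuousAt.inner
      continuousAt_const
  have hc1 : (0 : ℝ) < inner ℝ (frenetVector α 2 s) (frenetVector α 2 s) := by
    have := inner_frenetVector (hα.linearIndependent s hs) (i := 1) (j := 1) (by omega) (by omega)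
    rw [this, if_pos rfl]
    exact one_pos
  filter_upwards [hI.mem_nhds hs, hc.eventually (lt_mem_nhds hc1)] with x hx hpos
  -- The unit vector e_2(s) expanded in the frame at x.
  have h1 : inner ℝ (frenetVector α 1 x) (frenetVector α 2 s) ^ 2 +
      inner ℝ (frenetVector α 2 x) (frenetVector α 2 s) ^ 2 = 1 := by
    have h2 := eq_sum_inner_frenetVector (hα.linearIndependent x hx) (frenetVector α 2 s)
    have h3 := inner_frenetVector (hα.linearIndependent s hs) (i := 1) (j := 1)
      (by omega) (by omega)
    rw [if_pos rfl] at h3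
    have h4 := congrArg (fun y => inner ℝ y (frenetVector α 2 s)) h2
    simp only [Fin.sum_univ_two, Fin.val_zero, Fin.val_one, zero_add, inner_add_left,
      real_inner_smul_left, one_add_one_eq_two] at h4 h3
    rw [h3, real_inner_comm (frenetVector α 1 x), real_inner_comm (frenetVector α 2 x)] at h4
    rw [h4]
    ring
  have hd : HasDerivAt (fun x => inner ℝ (frenetVector α 1 x) (frenetVector α 2 s))
      ((curvature α 1 x * ‖deriv α x‖) * inner ℝ (frenetVector α 2 x) (frenetVector α 2 s)) x := by
    have h2 := (hα.differentiableAt_frenetVector hI hx (i := 0) (by omega)).hasDerivAt.inner ℝ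
      (hasDerivAt_const x (frenetVector α 2 s))
    refine h2.congr_deriv ?_
    rw [zero_add, hα.deriv_frenetVector_one le_rfl hI hx, real_inner_smul_left]
    simp
  have hsqrt : Real.sqrt (1 - inner ℝ (frenetVector α 1 x) (frenetVector α 2 s) ^ 2) =
      inner ℝ (frenetVector α 2 x) (frenetVector α 2 s) := by
    rw [← h1, add_sub_cancel_left, Real.sqrt_sq hpos.le]
  have hsq := pow_pos hpos 2
  refine ((Real.hasDerivAt_arcsin (x := inner ℝ (frenetVector α 1 x) (frenetVector α 2 s))
    ?_ ?_).comp x hd).congr_deriv ?_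
  · intro h
    rw [h] at h1
    linarith
  · intro h
    rw [h] at h1
    linarith
  · rw [hsqrt]
    field_simp

theorem hasDerivAt_integral_curvature (hα : IsFrenetCurve α I) (hn : 2 ≤ n) (hI : IsOpen I)
    (hIconn : I.OrdConnected) (hk : ∀ s ∈ I, curvature α 1 s ≠ 0) {s₀ s : ℝ} (hs₀ : s₀ ∈ I)
    (hs : s ∈ I) : HasDerivAt (fun s => ∫ u in s₀..s, curvature α 1 u * ‖deriv α u‖)
      (curvature α 1 s * ‖deriv α s‖) s := by
  rcases hn.lt_or_eq with h | h
  · exact hasDerivAt_integral_of_continuousOn hI hIconn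
      (hα.continuousOn_curvature_one_mul_norm h hI) hs₀ hs
  · subst h
    exact hasDerivAt_integral_of_local_primitive
      (κ := fun u => curvature α 1 u * ‖deriv α u‖) hI hIconn
      (fun s hs => mul_ne_zero (hk s hs) (norm_ne_zero_iff.2 (hα.deriv_ne_zero le_rfl hs)))
      (fun s hs => hα.exists_angle hI hs) hs₀ hs

end IsFrenetCurve

/-! ### From torus geodesics to constant curvature ratios. -/

section ConstantGram

variable {E : Type*} [NormedAddCommGroup E] [InnerProductSpace ℝ E] {g : ℕ → ℝ → E} {κ : ℝ → ℝ}
  {I : Set ℝ}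

/-- The span consists of combinations of the functions g j with constant coefficients; it is closed
under d/dτ, where dτ = κ ds. The Frenet vectors will be found in it. -/
theorem exists_hasDerivAt_of_mem_span
    (hg : ∀ j, ∀ s ∈ I, HasDerivAt (g j) (κ s • g (j + 1) s) s) {f : ℝ → E}
    (hf : f ∈ Submodule.span ℝ (Set.range g)) :
    ∃ f' ∈ Submodule.span ℝ (Set.range g), ∀ s ∈ I, HasDerivAt f (κ s • f' s) s := by
  induction hf using Submodule.span_induction with
  | mem f hf =>
    obtain ⟨j, rfl⟩ := hf
    exact ⟨g (j + 1), Submodule.subset_span ⟨j + 1, rfl⟩, hg j⟩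
  | zero => exact ⟨0, Submodule.zero_mem _, fun s _ => by simp⟩
  | add x y _ _ hx hy =>
    obtain ⟨x', hx', hx⟩ := hx
    obtain ⟨y', hy', hy⟩ := hy
    refine ⟨x' + y', Submodule.add_mem _ hx' hy', fun s hs => ?_⟩
    exact ((hx s hs).add (hy s hs)).congr_deriv (by simp)
  | smul a x _ hx =>
    obtain ⟨x', hx', hx⟩ := hx
    refine ⟨a • x', Submodule.smul_mem _ _ hx', fun s hs => ?_⟩
    exact ((hx s hs).const_smul a).congr_deriv (smul_comm _ _ _)

theorem exists_inner_eq_of_mem_span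
    (hg : ∀ i j, ∃ c, ∀ s ∈ I, inner ℝ (g i s) (g j s) = (c : ℝ)) {f h : ℝ → E}
    (hf : f ∈ Submodule.span ℝ (Set.range g)) (hh : h ∈ Submodule.span ℝ (Set.range g)) :
    ∃ c, ∀ s ∈ I, inner ℝ (f s) (h s) = (c : ℝ) := by
  induction hf using Submodule.span_induction with
  | mem f hf =>
    obtain ⟨i, rfl⟩ := hf
    induction hh using Submodule.span_induction with
    | mem h hh =>
      obtain ⟨j, rfl⟩ := hh
      exact hg i j
    | zero => exact ⟨0, fun s _ => by simp⟩
    | add x y _ _ hx hy =>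
      obtain ⟨a, ha⟩ := hx
      obtain ⟨b, hb⟩ := hy
      exact ⟨a + b, fun s hs => by rw [Pi.add_apply, inner_add_right, ha s hs, hb s hs]⟩
    | smul r x _ hx =>
      obtain ⟨a, ha⟩ := hx
      exact ⟨r * a, fun s hs => by rw [Pi.smul_apply, real_inner_smul_right, ha s hs]⟩
  | zero => exact ⟨0, fun s _ => by simp⟩
  | add x y _ _ hx hy =>
    obtain ⟨a, ha⟩ := hx
    obtain ⟨b, hb⟩ := hy
    exact ⟨a + b, fun s hs => by rw [Pi.add_apply, inner_add_left, ha s hs, hb s hs]⟩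
  | smul r x _ hx =>
    obtain ⟨a, ha⟩ := hx
    exact ⟨r * a, fun s hs => by rw [Pi.smul_apply, real_inner_smul_left, ha s hs]⟩

end ConstantGram

namespace IsFrenetCurve

variable {n : ℕ} {α : ℝ → EuclideanSpace ℝ (Fin n)} {I : Set ℝ}

theorem frenetVector_zero (hn : 2 ≤ n) (α : ℝ → EuclideanSpace ℝ (Fin n)) :
    frenetVector α 0 = frenetVector α 1 := by
  ext1 s
  rw [frenetVector_of_lt α (by omega), frenetVector_of_lt α (by omega)]

/-- If `e_1` and its iterated derivatives with respect to `κ ds` have constant inner products, then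
all curvatures are constant multiples of `κ`. -/
theorem exists_inner_deriv_frenetVector_eq_mul (hα : IsFrenetCurve α I) (hn : 2 ≤ n)
    (hI : IsOpen I) (hconn : IsPreconnected I) {s₀ : ℝ} (hs₀ : s₀ ∈ I)
    (hk : ∀ i, 1 ≤ i → i < n → ∀ s ∈ I, curvature α i s ≠ 0) {κ : ℝ → ℝ} (hκ : ∀ s ∈ I, κ s ≠ 0)
    {g : ℕ → ℝ → EuclideanSpace ℝ (Fin n)} (hg0 : g 0 = frenetVector α 1)
    (hg : ∀ j, ∀ s ∈ I, HasDerivAt (g j) (κ s • g (j + 1) s) s)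
    (hgg : ∀ i j, ∃ c, ∀ s ∈ I, inner ℝ (g i s) (g j s) = (c : ℝ)) {i : ℕ} (hi : i + 1 < n) :
    ∃ c : ℝ, ∀ s ∈ I,
      inner ℝ (deriv (frenetVector α (i + 1)) s) (frenetVector α (i + 2) s) = κ s * c := by
  have step : ∀ i, i + 1 < n → ∀ c : ℝ,
      ∀ f ∈ Submodule.span ℝ (Set.range g), ∀ f₀ ∈ Submodule.span ℝ (Set.range g),
      (∀ s ∈ I, frenetVector α (i + 1) s = f s) → (∀ s ∈ I, frenetVector α i s = f₀ s) →
      (∀ s ∈ I, inner ℝ (deriv (frenetVector α (i + 1)) s) (frenetVector α i s) = κ s * c) →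
      ∃ c' : ℝ, (∀ s ∈ I, inner ℝ (deriv (frenetVector α (i + 1)) s) (frenetVector α (i + 2) s) =
        κ s * c') ∧
        ∃ h ∈ Submodule.span ℝ (Set.range g), ∀ s ∈ I, frenetVector α (i + 2) s = h s := by
    intro i hi c f hf f₀ hf₀ hfe hfe₀ hc
    obtain ⟨f', hf', hd⟩ := exists_hasDerivAt_of_mem_span hg hf
    -- One Gram–Schmidt step: de_{i+1}/dτ minus its e_i-component, hence a multiple q of e_{i+2}.
    -- The coefficient c comes from the preceding step.
    set h := f' - c • f₀ with hh
    have hmem : h ∈ Submodule.span ℝ (Set.range g) :=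
      Submodule.sub_mem _ hf' (Submodule.smul_mem _ _ hf₀)
    obtain ⟨d, hd'⟩ := exists_inner_eq_of_mem_span hgg hmem hmem
    set q : ℝ → ℝ := fun s => inner ℝ (h s) (frenetVector α (i + 2) s) with hq
    have hKne : ∀ s ∈ I,
        inner ℝ (deriv (frenetVector α (i + 1)) s) (frenetVector α (i + 2) s) ≠ 0 := by
      intro s hs
      rw [← hα.curvature_mul_norm hn hs]
      exact mul_ne_zero (hk _ (by omega) hi s hs) (norm_ne_zero_iff.2 (hα.deriv_ne_zero hn hs))
    have hunit : ∀ s ∈ I, inner ℝ (frenetVector α (i + 2) s) (frenetVector α (i + 2) s) = 1 := by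
      intro s hs
      have := inner_frenetVector (hα.linearIndependent s hs) (i := i + 1) (j := i + 1) hi hi
      rwa [if_pos rfl] at this
    have hde : ∀ s ∈ I, deriv (frenetVector α (i + 1)) s = κ s • f' s := by
      intro s hs
      exact ((hd s hs).congr_of_eventuallyEq
        (Filter.eventuallyEq_of_mem (hI.mem_nhds hs) hfe)).deriv
    have hKh : ∀ s ∈ I,
        inner ℝ (deriv (frenetVector α (i + 1)) s) (frenetVector α (i + 2) s) •
          frenetVector α (i + 2) s = κ s • h s := by
      intro s hs
      have h1 := hα.deriv_frenetVector_eq_sum hI hs hi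
      rw [hc s hs, ← sub_eq_iff_eq_add] at h1
      rw [← h1, hde s hs, hfe₀ s hs, hh, Pi.sub_apply, Pi.smul_apply, smul_sub, smul_smul]
    have hKq : ∀ s ∈ I,
        inner ℝ (deriv (frenetVector α (i + 1)) s) (frenetVector α (i + 2) s) = κ s * q s := by
      intro s hs
      have h1 := congrArg (fun y => inner ℝ y (frenetVector α (i + 2) s)) (hKh s hs)
      simpa only [real_inner_smul_left, hunit s hs, mul_one] using h1
    have hhq : ∀ s ∈ I, h s = q s • frenetVector α (i + 2) s := by
      intro s hs
      have h1 := hKh s hs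
      rw [hKq s hs, mul_smul] at h1
      exact (smul_right_injective _ (hκ s hs) h1).symm
    have hqne : ∀ s ∈ I, q s ≠ 0 := by
      intro s hs h0
      apply hKne s hs
      rw [hKq s hs, h0, mul_zero]
    have hqsq : ∀ s ∈ I, q s ^ 2 = d := by
      intro s hs
      rw [← hd' s hs, hhq s hs, real_inner_smul_left, real_inner_smul_right, hunit s hs]
      ring
    have hqcont : ContinuousOn q I := by
      obtain ⟨h', _, hh'⟩ := exists_hasDerivAt_of_mem_span hg hmem
      intro s hs
      exact ((hh' s hs).continuousAt.inner (hα.differentiableAt_frenetVector hI hs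
        (i := i + 1) hi).continuousAt).continuousWithinAt
    -- The square q² = ‖h‖² is constant; continuity and connectedness fix the sign.
    have hqconst : Set.EqOn q (fun _ => q s₀) I := by
      refine hconn.eq_of_sq_eq hqcont continuousOn_const (fun s hs => ?_)
        (fun _ => hqne s₀ hs₀) hs₀ rfl
      simp only [Pi.pow_apply, hqsq s hs, hqsq s₀ hs₀]
    refine ⟨q s₀, fun s hs => by rw [hKq s hs, hqconst hs], (q s₀)⁻¹ • h,
      Submodule.smul_mem _ _ hmem, fun s hs => ?_⟩
    rw [Pi.smul_apply, hhq s hs, hqconst hs, inv_smul_smul₀ (hqne s₀ hs₀)]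
  have main : ∀ i, i + 1 < n → ∃ c : ℝ,
      ∃ f ∈ Submodule.span ℝ (Set.range g), ∃ f₀ ∈ Submodule.span ℝ (Set.range g),
      (∀ s ∈ I, frenetVector α (i + 1) s = f s) ∧ (∀ s ∈ I, frenetVector α i s = f₀ s) ∧
      (∀ s ∈ I, inner ℝ (deriv (frenetVector α (i + 1)) s) (frenetVector α i s) = κ s * c) := by
    intro i
    induction i with
    | zero =>
      intro hi
      have h0 : g 0 ∈ Submodule.span ℝ (Set.range g) := Submodule.subset_span ⟨0, rfl⟩
      refine ⟨0, g 0, h0, g 0, h0, fun s _ => by rw [hg0], fun s _ => by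
        rw [hg0, frenetVector_zero hn], fun s hs => ?_⟩
      rw [frenetVector_zero hn, hα.inner_deriv_frenetVector_self hI hs (i := 0) (by omega),
        mul_zero]
    | succ i ih =>
      intro hi
      obtain ⟨c, f, hf, f₀, hf₀, h1, h2, h3⟩ := ih (by omega)
      obtain ⟨c', hc', h, hh, h4⟩ := step i (by omega) c f hf f₀ hf₀ h1 h2 h3
      refine ⟨-c', h, hh, f, hf, h4, h1, fun s hs => ?_⟩
      rw [hα.inner_deriv_frenetVector_swap hI hs (by omega) (by omega), hc' s hs, mul_neg]
  obtain ⟨c, f, hf, f₀, hf₀, h1, h2, h3⟩ := main i hi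
  obtain ⟨c', hc', -⟩ := step i hi c f hf f₀ hf₀ h1 h2 h3
  exact ⟨c', hc'⟩

theorem hasConstantCurvatureRatios_of_eq (hα : IsFrenetCurve α I) (hn : 2 ≤ n)
    (hI : IsOpen I) (hconn : IsPreconnected I) {s₀ : ℝ} (hs₀ : s₀ ∈ I)
    (hk : ∀ i, 1 ≤ i → i < n → ∀ s ∈ I, curvature α i s ≠ 0) {τ : ℝ → ℝ}
    (hτ : ∀ s ∈ I, HasDerivAt τ (curvature α 1 s * ‖deriv α s‖) s)
    {γ : ℝ → EuclideanSpace ℝ (Fin n)}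
    {C : EuclideanSpace ℝ (Fin n) →L[ℝ] EuclideanSpace ℝ (Fin n)}
    (hC : ∀ x y, inner ℝ (C x) y = -inner ℝ x (C y)) (hγ : ∀ t, HasDerivAt γ (C (γ t)) t)
    (Φ : EuclideanSpace ℝ (Fin n) ≃ᵢ EuclideanSpace ℝ (Fin n))
    (hΦ : ∀ s ∈ I, frenetVector α 1 s = Φ (γ (τ s))) : HasConstantCurvatureRatios α I := by
  set κ : ℝ → ℝ := fun s => curvature α 1 s * ‖deriv α s‖ with hκdef
  have hκ : ∀ s ∈ I, κ s ≠ 0 := fun s hs =>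
    mul_ne_zero (hk 1 le_rfl (by omega) s hs) (norm_ne_zero_iff.2 (hα.deriv_ne_zero hn hs))
  set L := Φ.toRealLinearIsometryEquiv with hL
  -- Only g 0 = e_1 sees the translation part of Φ; the derivatives involve the linear part L alone.
  let g : ℕ → ℝ → EuclideanSpace ℝ (Fin n) := fun j =>
    if j = 0 then frenetVector α 1 else fun s => L ((C ^ j) (γ (τ s)))
  have hg0 : g 0 = frenetVector α 1 := rfl
  have hgs : ∀ j s, g (j + 1) s = L ((C ^ (j + 1)) (γ (τ s))) := fun j s => rfl
  have hd : ∀ j, ∀ s ∈ I, HasDerivAt (fun s => L ((C ^ j) (γ (τ s)))) (κ s • g (j + 1) s) s := by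
    intro j s hs
    have h1 := (HasDerivAt.clm_pow_apply hγ j (τ s)).scomp s (hτ s hs)
    have h2 := L.toContinuousLinearEquiv.hasFDerivAt.comp_hasDerivAt s h1
    exact h2.congr_deriv (by simp [hgs, κ])
  have hg : ∀ j, ∀ s ∈ I, HasDerivAt (g j) (κ s • g (j + 1) s) s := by
    rintro (_ | j) s hs
    · refine ((hd 0 s hs).add_const (Φ 0)).congr_of_eventuallyEq
        (Filter.eventuallyEq_of_mem (hI.mem_nhds hs) fun x hx => ?_)
      rw [hg0, hΦ x hx, hL]
      simp
    · exact hd (j + 1) s hs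
  have hunit : ∀ s ∈ I, inner ℝ (g 0 s) (g 0 s) = 1 := by
    intro s hs
    have := inner_frenetVector (hα.linearIndependent s hs) (i := 0) (j := 0) (by omega) (by omega)
    rwa [if_pos rfl] at this
  have hgg1 : ∀ i j, ∃ c, ∀ s ∈ I, inner ℝ (g (i + 1) s) (g (j + 1) s) = (c : ℝ) := by
    intro i j
    refine ⟨inner ℝ ((C ^ (i + 1)) (γ 0)) ((C ^ (j + 1)) (γ 0)), fun s _ => ?_⟩
    rw [hgs, hgs, LinearIsometryEquiv.inner_map_map, inner_clm_pow_apply_eq hγ hC _ _ (τ s) 0]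
  -- Because of the translation, invariance along γ does not cover g 0. Instead ‖g 0‖ = 1 is
  -- differentiated repeatedly: ⟨g 0, g (j + 1)⟩ = -⟨g 1, g j⟩.
  have hgg0 : ∀ j, ∃ c, ∀ s ∈ I, inner ℝ (g 0 s) (g j s) = (c : ℝ) := by
    intro j
    induction j with
    | zero => exact ⟨1, hunit⟩
    | succ j ih =>
      obtain ⟨c, hc⟩ := ih
      have hderiv : ∀ s ∈ I, inner ℝ (g 0 s) (g (j + 1) s) + inner ℝ (g 1 s) (g j s) = 0 := by
        intro s hs
        have h1 := inner_deriv_add_inner_deriv hI hs (hg 0 s hs).differentiableAt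
          (hg j s hs).differentiableAt hc
        rw [(hg 0 s hs).deriv, (hg j s hs).deriv, real_inner_smul_left, real_inner_smul_right,
          ← mul_add] at h1
        exact (mul_eq_zero.1 h1).resolve_left (hκ s hs)
      rcases j with _ | j
      · refine ⟨0, fun s hs => ?_⟩
        have h1 := hderiv s hs
        rw [real_inner_comm (g 0 s) (g 1 s)] at h1
        linarith
      · obtain ⟨d, hd⟩ := hgg1 0 j
        refine ⟨-d, fun s hs => ?_⟩
        have h1 := hderiv s hs
        have h2 := hd s hs
        rw [zero_add] at h2
        linarith
  have hgg : ∀ i j, ∃ c, ∀ s ∈ I, inner ℝ (g i s) (g j s) = (c : ℝ) := by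
    rintro (_ | i) (_ | j)
    · exact hgg0 0
    · exact hgg0 (j + 1)
    · obtain ⟨c, hc⟩ := hgg0 (i + 1)
      exact ⟨c, fun s hs => by rw [real_inner_comm, hc s hs]⟩
    · exact hgg1 i j
  have key : ∀ i, 1 ≤ i → i < n → ∃ c : ℝ, ∀ s ∈ I, curvature α i s = κ s * c / ‖deriv α s‖ := by
    intro i h1 h2
    obtain ⟨j, rfl⟩ : ∃ j, i = j + 1 := ⟨i - 1, by omega⟩
    obtain ⟨c, hc⟩ := hα.exists_inner_deriv_frenetVector_eq_mul hn hI hconn hs₀ hk hκ hg0 hg hgg h2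
    exact ⟨c, fun s hs => by rw [← hc s hs]; rfl⟩
  intro i h1 h2
  obtain ⟨c, hc⟩ := key i h1 (by omega)
  obtain ⟨c', hc'⟩ := key (i + 1) (by omega) h2
  refine ⟨c' / c, fun s hs => ?_⟩
  have hne := hk i h1 (by omega) s hs
  rw [hc s hs] at hne
  rw [hc s hs, hc' s hs]
  have h3 : ‖deriv α s‖ ≠ 0 := norm_ne_zero_iff.2 (hα.deriv_ne_zero hn hs)
  have h4 := hκ s hs
  have h5 : c ≠ 0 := by
    rintro rfl
    simp at hne
  field_simp

end IsFrenetCurve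

/-! ### From constant curvature ratios to torus geodesics. -/

/-- The terms M' exp(-τB) = κ M B exp(-τB) and -κ M B exp(-τB) cancel, so the product is constant.
-/
theorem mul_exp_neg_smul_eq {𝔸 : Type*} [NormedRing 𝔸] [NormedAlgebra ℝ 𝔸] [CompleteSpace 𝔸]
    {I : Set ℝ} (hI : IsOpen I) (hconn : IsPreconnected I) {M : ℝ → 𝔸} {B : 𝔸} {τ κ : ℝ → ℝ}
    (hτ : ∀ s ∈ I, HasDerivAt τ (κ s) s) (hM : ∀ s ∈ I, HasDerivAt M (κ s • (M s * B)) s)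
    {s₀ s : ℝ} (hs₀ : s₀ ∈ I) (hτ₀ : τ s₀ = 0) (hs : s ∈ I) :
    M s * NormedSpace.exp ((-τ s) • B) = M s₀ := by
  have h1 : ∀ s ∈ I, HasDerivAt (fun s => M s * NormedSpace.exp ((-τ s) • B)) 0 s := by
    intro s hs
    have h3 := (hasDerivAt_exp_smul_const' (𝕂 := ℝ) B (-τ s)).scomp s (hτ s hs).neg
    refine ((hM s hs).mul h3).congr_deriv ?_
    simp only [Function.comp_apply, Pi.neg_apply, smul_mul_assoc, mul_smul_comm, neg_smul,
      mul_assoc, mul_neg, add_neg_cancel]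
  have h2 := hI.is_const_of_deriv_eq_zero hconn
    (fun s hs => (h1 s hs).differentiableAt.differentiableWithinAt)
    (fun s hs => (h1 s hs).deriv) hs hs₀
  simpa [hτ₀] using h2

theorem exp_neg_smul_apply_eq {E : Type*} [NormedAddCommGroup E] [NormedSpace ℝ E]
    [CompleteSpace E] {B : E →L[ℝ] E} {Γ : ℝ → E} (hΓ : ∀ t, HasDerivAt Γ (B (Γ t)) t) (t : ℝ) :
    NormedSpace.exp ((-t) • B) (Γ t) = Γ 0 := by
  have h3 : ∀ t, HasDerivAt (fun t => NormedSpace.exp ((-t) • B) (Γ t)) 0 t := by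
    intro t
    have h4 := (hasDerivAt_exp_smul_const (𝕂 := ℝ) B (-t)).scomp t (hasDerivAt_id t).neg
    refine (h4.clm_apply (hΓ t)).congr_deriv ?_
    simp
  have := is_const_of_deriv_eq_zero (fun t => (h3 t).differentiableAt) (fun t => (h3 t).deriv) t 0
  simpa using this

section MovingFrame

variable {n : ℕ}

/-- The linear map sending the standard basis of `ℝⁿ` to the vectors `v 0, …, v (n - 1)`. -/
noncomputable def frameMap (v : Fin n → EuclideanSpace ℝ (Fin n)) :
    EuclideanSpace ℝ (Fin n) →L[ℝ] EuclideanSpace ℝ (Fin n) :=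
  ∑ i, (EuclideanSpace.proj i : EuclideanSpace ℝ (Fin n) →L[ℝ] ℝ).smulRight (v i)

theorem frameMap_apply (v : Fin n → EuclideanSpace ℝ (Fin n)) (x : EuclideanSpace ℝ (Fin n)) :
    frameMap v x = ∑ i, x i • v i := by
  simp [frameMap]

theorem frameMap_single (v : Fin n → EuclideanSpace ℝ (Fin n)) (i : Fin n) :
    frameMap v (EuclideanSpace.single i 1) = v i := by
  rw [frameMap_apply, Finset.sum_eq_single i]
  · simp
  · intro j _ hj
    simp [hj]
  · simp

theorem HasDerivAt.frameMap {v : Fin n → ℝ → EuclideanSpace ℝ (Fin n)}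
    {v' : Fin n → EuclideanSpace ℝ (Fin n)} {s : ℝ} (hv : ∀ i, HasDerivAt (v i) (v' i) s) :
    HasDerivAt (fun s => frameMap fun i => v i s) (frameMap v') s := by
  unfold _root_.frameMap
  refine HasDerivAt.fun_sum fun i _ => ?_
  exact ((ContinuousLinearMap.smulRightL ℝ (EuclideanSpace ℝ (Fin n)) (EuclideanSpace ℝ (Fin n))
    (EuclideanSpace.proj i)).hasFDerivAt.comp_hasDerivAt s (hv i))

/-- The rows of the matrix `A` as images of the standard basis. -/
noncomputable def rowMap (A : Fin n → Fin n → ℝ) :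
    EuclideanSpace ℝ (Fin n) →L[ℝ] EuclideanSpace ℝ (Fin n) :=
  frameMap fun i => WithLp.toLp 2 (A i)

theorem rowMap_skew {A : Fin n → Fin n → ℝ} (hA : ∀ i j, A i j = -A j i)
    (x y : EuclideanSpace ℝ (Fin n)) :
    inner ℝ (rowMap A x) y = -inner ℝ x (rowMap A y) := by
  have h : ∀ x y : EuclideanSpace ℝ (Fin n),
      inner ℝ (rowMap A x) y = ∑ i, ∑ j, x i * y j * A i j := by
    intro x y
    rw [rowMap, frameMap_apply, sum_inner]
    refine Finset.sum_congr rfl fun i _ => ?_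
    rw [real_inner_smul_left, PiLp.inner_apply, Finset.mul_sum]
    refine Finset.sum_congr rfl fun j _ => ?_
    simp only [RCLike.inner_apply, conj_trivial]
    ring
  rw [← real_inner_comm x, h, h, Finset.sum_comm, ← Finset.sum_neg_distrib]
  refine Finset.sum_congr rfl fun i _ => ?_
  rw [← Finset.sum_neg_distrib]
  refine Finset.sum_congr rfl fun j _ => ?_
  rw [hA i j]
  ring

theorem frameMap_mul_rowMap (v : Fin n → EuclideanSpace ℝ (Fin n)) (A : Fin n → Fin n → ℝ) :
    frameMap v * rowMap A = frameMap fun i => ∑ j, A i j • v j := by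
  ext1 x
  rw [mul_apply_eq_comp, rowMap, frameMap_apply _ x, frameMap_apply _ x, map_sum]
  refine Finset.sum_congr rfl fun i _ => ?_
  rw [map_smul, frameMap_apply]

/-- A moving frame whose derivative has constant coefficients with respect to `dτ` is carried along
by the flow of these coefficients. -/
theorem frameMap_apply_flow {I : Set ℝ} (hI : IsOpen I) (hconn : IsPreconnected I)
    {v : Fin n → ℝ → EuclideanSpace ℝ (Fin n)} {A : Fin n → Fin n → ℝ} {τ κ : ℝ → ℝ}
    (hτ : ∀ s ∈ I, HasDerivAt τ (κ s) s)
    (hv : ∀ i, ∀ s ∈ I, HasDerivAt (v i) (κ s • ∑ j, A i j • v j s) s)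
    {Γ : ℝ → EuclideanSpace ℝ (Fin n)} (hΓ : ∀ t, HasDerivAt Γ (rowMap A (Γ t)) t)
    {s₀ s : ℝ} (hs₀ : s₀ ∈ I) (hτ₀ : τ s₀ = 0) (hs : s ∈ I) :
    frameMap (fun i => v i s) (Γ 0) = frameMap (fun i => v i s₀) (Γ (τ s)) := by
  set B := rowMap A with hB
  have h1 : ∀ s ∈ I, HasDerivAt (fun s => frameMap fun i => v i s)
      (κ s • (frameMap (fun i => v i s) * B)) s := by
    intro s hs
    refine (HasDerivAt.frameMap fun i => hv i s hs).congr_deriv ?_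
    rw [hB, frameMap_mul_rowMap]
    ext1 x
    rw [smul_apply, frameMap_apply, frameMap_apply, Finset.smul_sum]
    exact Finset.sum_congr rfl fun i _ => smul_comm _ _ _
  -- With M the frame map, M(s₀) Γ(τ) = M(s) exp(-τB) Γ(τ) = M(s) Γ(0).
  rw [← mul_exp_neg_smul_eq hI hconn hτ h1 hs₀ hτ₀ hs, mul_apply_eq_comp,
    exp_neg_smul_apply_eq hΓ]

end MovingFrame

namespace IsFrenetCurve

variable {n : ℕ} {α : ℝ → EuclideanSpace ℝ (Fin n)} {I : Set ℝ}

/-- Multiplying the ratios telescopes to k_{i+1} / k_1. That these constants are nonzero is what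
later makes the first basis vector cyclic. -/
theorem exists_curvature_eq_mul {s₀ : ℝ} (hs₀ : s₀ ∈ I)
    (hk : ∀ i, 1 ≤ i → i < n → ∀ s ∈ I, curvature α i s ≠ 0)
    (h : HasConstantCurvatureRatios α I) :
    ∃ c : ℕ → ℝ, ∀ i, i + 1 < n → c i ≠ 0 ∧
      ∀ s ∈ I, curvature α (i + 1) s = curvature α 1 s * c i := by
  have key : ∀ i, ∃ c : ℝ, i + 1 < n → c ≠ 0 ∧
      ∀ s ∈ I, curvature α (i + 1) s = curvature α 1 s * c := by
    intro i
    induction i with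
    | zero => exact ⟨1, fun _ => ⟨one_ne_zero, fun s _ => (mul_one _).symm⟩⟩
    | succ i ih =>
      by_cases hi : i + 1 + 1 < n
      · obtain ⟨c, hc⟩ := ih
        obtain ⟨hc0, hc⟩ := hc (by omega)
        obtain ⟨d, hd⟩ := h (i + 1) (by omega) hi
        have hd' : ∀ s ∈ I, curvature α (i + 1 + 1) s = curvature α 1 s * (c * d) := by
          intro s hs
          rw [← mul_assoc, ← hc s hs, ← hd s hs,
            mul_div_cancel₀ _ (hk (i + 1) (by omega) (by omega) s hs)]
        refine ⟨c * d, fun _ => ⟨fun h0 => ?_, hd'⟩⟩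
        apply hk (i + 1 + 1) (by omega) hi s₀ hs₀
        rw [hd' s₀ hs₀, h0, mul_zero]
      · exact ⟨0, fun h => absurd h hi⟩
  choose c hc using key
  exact ⟨c, hc⟩

theorem exists_isTwistedTorusGeodesic (hα : IsFrenetCurve α I) (hn : 2 ≤ n)
    (hI : IsOpen I) (hconn : IsPreconnected I) {s₀ : ℝ} (hs₀ : s₀ ∈ I)
    (hk : ∀ i, 1 ≤ i → i < n → ∀ s ∈ I, curvature α i s ≠ 0) {τ : ℝ → ℝ} (hτ₀ : τ s₀ = 0)
    (hτ : ∀ s ∈ I, HasDerivAt τ (curvature α 1 s * ‖deriv α s‖) s)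
    (h : HasConstantCurvatureRatios α I) :
    ∃ (γ : ℝ → EuclideanSpace ℝ (Fin n))
      (Φ : EuclideanSpace ℝ (Fin n) ≃ᵢ EuclideanSpace ℝ (Fin n)),
      IsTwistedTorusGeodesic γ ∧ ∀ s ∈ I, frenetVector α 1 s = Φ (γ (τ s)) := by
  obtain ⟨c, hc⟩ := exists_curvature_eq_mul hs₀ hk h
  -- Coefficient of e_{j+1} in de_{i+1}/dτ.
  let A : ℕ → ℕ → ℝ := fun i j => if j = i + 1 then c i else if i = j + 1 then -c j else 0
  have hAskew : ∀ i j, A i j = -A j i := by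
    intro i j
    simp only [A]
    split_ifs <;> first | omega | simp
  have hA0 : ∀ i j, i + 1 < j → A i j = 0 := by
    intro i j hij
    simp only [A]
    rw [if_neg (by omega), if_neg (by omega)]
  have hA1 : ∀ i, A i (i + 1) = c i := fun i => by simp [A]
  have hAup : ∀ i j, i ≤ j → j < n → ∀ s ∈ I,
      inner ℝ (deriv (frenetVector α (i + 1)) s) (frenetVector α (j + 1) s) =
        (curvature α 1 s * ‖deriv α s‖) * A i j := by
    intro i j hij hj s hs
    rcases hij.lt_or_eq with h1 | rfl
    · rcases (Nat.succ_le_of_lt h1).lt_or_eq with h2 | h2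
      · rw [hα.inner_deriv_frenetVector_eq_zero hI hs h2 hj, hA0 i j h2, mul_zero]
      · subst h2
        rw [hA1, ← hα.curvature_mul_norm hn hs, (hc i hj).2 s hs]
        ring
    · rw [hα.inner_deriv_frenetVector_self hI hs hj]
      simp [A]
  have hAall : ∀ i j, i < n → j < n → ∀ s ∈ I,
      inner ℝ (deriv (frenetVector α (i + 1)) s) (frenetVector α (j + 1) s) =
        (curvature α 1 s * ‖deriv α s‖) * A i j := by
    intro i j hi hj s hs
    rcases le_total i j with hij | hij
    · exact hAup i j hij hj s hs
    · rw [hα.inner_deriv_frenetVector_swap hI hs hi hj, hAup j i hij hi s hs, hAskew i j]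
      ring
  set B := rowMap fun i j : Fin n => A i j with hB
  have hBskew : ∀ x y, inner ℝ (B x) y = -inner ℝ x (B y) :=
    rowMap_skew fun i j => hAskew i j
  let b : ℕ → EuclideanSpace ℝ (Fin n) := fun i =>
    if hi : i < n then EuclideanSpace.single ⟨i, hi⟩ 1 else 0
  have hb : ∀ i : Fin n, b i = EuclideanSpace.single i 1 := fun i => by simp [b]
  have hBb : ∀ i < n, B (b i) = ∑ j ∈ Finset.range n, A i j • b j := by
    intro i hi
    rw [hb ⟨i, hi⟩, hB, rowMap, frameMap_single, Finset.sum_range]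
    ext j
    simp [hb, Pi.single_apply]
  have hspan : ∀ i < n, b i ∈ Submodule.span ℝ ((fun j => (B ^ j) (b 0)) '' Set.Iic i) :=
    fun i hi => mem_span_clm_pow_of_tridiagonal hBb (fun i j hij _ => hA0 i j hij)
      (fun i hi => by rw [hA1]; exact (hc i hi).1) hi
  have hbtop : ∀ S : Submodule ℝ (EuclideanSpace ℝ (Fin n)), (∀ i < n, b i ∈ S) → S = ⊤ := by
    intro S hS
    rw [eq_top_iff, ← (EuclideanSpace.basisFun (Fin n) ℝ).toBasis.span_eq, Submodule.span_le]
    rintro _ ⟨i, rfl⟩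
    simpa [hb] using hS i i.2
  have hcyc : ∀ S : Submodule ℝ (EuclideanSpace ℝ (Fin n)), b 0 ∈ S → (∀ y ∈ S, B y ∈ S) →
      S = ⊤ := by
    intro S h0 hS
    refine hbtop S fun i hi => ?_
    refine (Submodule.span_le.2 ?_) (hspan i hi)
    rintro _ ⟨j, -, rfl⟩
    induction j with
    | zero => simpa using h0
    | succ j ih =>
      simp only [pow_succ', mul_apply_eq_comp]
      exact hS _ ih
  have hli : LinearIndependent ℝ fun j : Fin n => (B ^ (j : ℕ)) (b 0) := by
    refine linearIndependent_of_top_le_span_of_card_eq_finrank ?_ (by simp)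
    refine (hbtop _ fun i hi => Submodule.span_mono ?_ (hspan i hi)).ge
    rintro _ ⟨j, hj, rfl⟩
    exact ⟨⟨j, lt_of_le_of_lt hj hi⟩, rfl⟩
  obtain ⟨r, a, m, Ψ, hr, hm, hΨ0, hΨ⟩ := exists_flatTorus_of_skew hBskew hcyc
  set γ : ℝ → EuclideanSpace ℝ (Fin n) := fun t => flatTorus n r a fun l => m l * t with hγdef
  set C := torusRotation n m with hCdef
  have hγ : ∀ t, HasDerivAt γ (C (γ t)) t := hasDerivAt_flatTorus r a m
  have hpow : ∀ j, (C ^ j) (γ 0) = Ψ ((B ^ j) (b 0)) := by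
    intro j
    induction j with
    | zero => exact hΨ0.symm
    | succ j ih => rw [pow_succ', pow_succ', mul_apply_eq_comp, mul_apply_eq_comp, ih, hΨ]
  have hliC : ∀ t, LinearIndependent ℝ fun j : Fin n => (C ^ (j : ℕ)) (γ t) := by
    intro t
    refine linearIndependent_clm_pow_apply hγ (torusRotation_skew m) (t := 0) ?_
    simp only [hpow]
    exact hli.map' Ψ.toLinearEquiv.toLinearMap Ψ.toLinearEquiv.ker
  have ho := frenetVector_orthonormal (hα.linearIndependent s₀ hs₀)
  let f := OrthonormalBasis.mk ho
    (ho.linearIndependent.span_eq_top_of_card_eq_finrank' (by simp)).ge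
  have hf : ∀ x, f.repr.symm x = frameMap (fun i : Fin n => frenetVector α (i + 1) s₀) x := by
    intro x
    rw [frameMap_apply, ← f.sum_repr_symm]
    simp [f]
  -- Ψ⁻¹ takes the torus curve back to the orbit of B through the first basis vector, and the frame
  -- at s₀ takes that orbit to e_1.
  refine ⟨γ, (Ψ.symm.trans f.repr.symm).toIsometryEquiv, ⟨⟨r, a, m, hr, fun t => rfl⟩,
    isFrenetCurve_of_clm hγ hliC, curvature_ne_zero_of_clm hn (torusRotation_skew m)
      (fun hn2 x hx => torusRotation_injective hn2 hm hx) hγ hliC⟩, fun s hs => ?_⟩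
  have hΓ : ∀ t, HasDerivAt (fun t => Ψ.symm (γ t)) (B (Ψ.symm (γ t))) t := by
    intro t
    refine (Ψ.symm.toContinuousLinearEquiv.hasFDerivAt.comp_hasDerivAt t (hγ t)).congr_deriv ?_
    have := hΨ (Ψ.symm (γ t))
    rw [LinearIsometryEquiv.apply_symm_apply] at this
    simp [← this]
  have hv : ∀ i : Fin n, ∀ s ∈ I, HasDerivAt (frenetVector α (i + 1))
      ((curvature α 1 s * ‖deriv α s‖) • ∑ j : Fin n, A i j • frenetVector α (j + 1) s) s := by
    intro i s hs
    refine (hα.differentiableAt_frenetVector hI hs i.2).hasDerivAt.congr_deriv ?_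
    rw [eq_sum_inner_frenetVector (hα.linearIndependent s hs)
      (deriv (frenetVector α (i + 1)) s), Finset.smul_sum]
    refine Finset.sum_congr rfl fun j _ => ?_
    rw [hAall i j i.2 j.2 s hs, mul_smul]
  have key := frameMap_apply_flow hI hconn hτ hv hΓ hs₀ hτ₀ hs
  have h0 : Ψ.symm (γ 0) = EuclideanSpace.single (⟨0, by omega⟩ : Fin n) 1 := by
    rw [← hb ⟨0, by omega⟩, LinearIsometryEquiv.symm_apply_eq]
    exact hΨ0.symm
  simp only [h0] at key
  rw [frameMap_single] at key
  simpa [hf] using key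

end IsFrenetCurve

theorem mainTheorem1 (n : ℕ) (hn : 2 ≤ n) (α : ℝ → EuclideanSpace ℝ (Fin n))
    (I : Set ℝ) (hIopen : IsOpen I) (hIconn : I.OrdConnected) (s₀ : ℝ) (hs₀ : s₀ ∈ I)
    (hα : IsFrenetCurve α I)
    (hk : ∀ i, 1 ≤ i → i < n → ∀ s ∈ I, curvature α i s ≠ 0) :
    HasConstantCurvatureRatios α I ↔
      ∃ (γ : ℝ → EuclideanSpace ℝ (Fin n))
        (Φ : EuclideanSpace ℝ (Fin n) ≃ᵢ EuclideanSpace ℝ (Fin n)),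
        IsTwistedTorusGeodesic γ ∧
          ∀ s ∈ I, frenetVector α 1 s =
            Φ (γ (∫ u in s₀..s, curvature α 1 u * ‖deriv α u‖)) := by
  have hτ : ∀ s ∈ I, HasDerivAt (fun s => ∫ u in s₀..s, curvature α 1 u * ‖deriv α u‖)
      (curvature α 1 s * ‖deriv α s‖) s := fun s hs =>
    hα.hasDerivAt_integral_curvature hn hIopen hIconn (hk 1 le_rfl (by omega)) hs₀ hs
  constructor
  · exact hα.exists_isTwistedTorusGeodesic hn hIopen hIconn.isPreconnected hs₀ hk
      intervalIntegral.integral_same hτ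
  · rintro ⟨γ, Φ, ⟨⟨r, a, m, -, hγ⟩, -, -⟩, hΦ⟩
    obtain rfl : γ = fun t => flatTorus n r a fun l => m l * t := funext hγ
    exact hα.hasConstantCurvatureRatios_of_eq hn hIopen hIconn.isPreconnected hs₀ hk hτ
      (torusRotation_skew m) (hasDerivAt_flatTorus r a m) Φ hΦ
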